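/- Let $0<\alpha<1$. For $\lambda\ge 1$ let $\mathbb{T}_\lambda=\mathbb{R}/2\pi\lambda\mathbb{Z}$, with frequencies $\xi\in\mathbb{Z}/\lambda$; equip $\mathbb{Z}/\lambda$ with the counting measure divided by $2\pi\lambda$, let $\widehat u(\xi,\tau)=\int_{\mathbb{R}}\int_{\mathbb{T}_\lambda}e^{-i(x\xi+t\tau)}u(x,t)\,dx\,dt$ (in the sense of distributions where necessary), and let $\langle x\rangle=1+|x|$. For $a\in\mathbb{R}$ put $$\|u\|_{X_a^{s,b}}=\big\|\langle\xi\rangle^s\langle\tau-a\xi^3\rangle^b\,\widehat u\,\big\|_{L^2_{\xi,\tau}},\qquad \|u\|_{Y_a^s}=\|u\|_{X_a^{s,1/2}}+\big\|\langle\xi\rangle^s\,\widehat u\,\big\|_{L^2_\xi L^1_\tau},$$ $$\|u\|_{Z_a^s}=\|u\|_{X_a^{s,-1/2}}+\big\|\langle\xi\rangle^s\langle\tau-a\xi^3\rangle^{-1}\,\widehat u\,\big\|_{L^2_\xi L^1_\tau},$$ and $Y^s=Y_1^s$. For $s\ge 0$, $Y^s_a$ is the space of $u\in L^2(\mathbb{T}_\lambda\times\mathbb{R})$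 with $\|u\|_{Y^s_a}<\infty$, that is, the completion of the Schwartz class on $\mathbb{T}_\lambda\times\mathbb{R}$ in this norm. A real number $\rho$ is of type $\nu>0$ if there is $K>0$ with $|\rho-\frac mn|\ge K|n|^{-2-\nu}$ for all integers $m$ and $n\neq0$. The minimal type index is $\nu_\rho=\infty$ if $\rho\in\mathbb{Q}$, and $\nu_\rho=\inf\{\nu>0:\rho\text{ is of type }\nu\}\in[0,\infty]$ otherwise ($\inf\emptyset=\infty$). Let $$d_1=\frac{-3\alpha+\sqrt{3\alpha(4-\alpha)}}{2(1-\alpha)},\qquad d_2=\frac{-3\alpha-\sqrt{3\alpha(4-\alpha)}}{2(1-\alpha)},\qquad \nu=\max(\nu_{d_1},\nu_{d_2}).$$ Then for all $\varepsilon,\delta>0$ and all real $s\ge\min\big(1,\tfrac12+\tfrac12\nu+\varepsilon\big)$ there is a constant $C>0$, depending only on $\alpha,s,\varepsilon,\delta$, such that for every $\lambda\ge1$, every $u\in Y^s(\mathbb{T}_\lambda\times\mathbb{R})$ with $\int_{\mathbb{T}_\lambda}u(x,t)\,dx=0$ for almost every $t$, and every $v\in Y_\alpha^s(\mathbb{T}_\lambda\times\mathbb{R})$,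 $$\|\partial_x(uv)\|_{Z_\alpha^s(\mathbb{T}_\lambda\times\mathbb{R})}\le C\,C_2(\lambda)\,\|u\|_{Y^s(\mathbb{T}_\lambda\times\mathbb{R})}\,\|v\|_{Y_\alpha^s(\mathbb{T}_\lambda\times\mathbb{R})},\qquad C_2(\lambda)=\begin{cases}\lambda^{\frac12+\frac12\nu+\delta},&0\le\nu<1,\\ \lambda^{\delta},&\nu\ge1.\end{cases}$$ -/

import Mathlib

open MeasureTheory Complex
open scoped ENNReal SchwartzMap

/-! ### Diophantine type -/

/-- `ρ` is of type `ν`: `|ρ - m / n| ≥ K / |n| ^ (2 + ν)` for some `K > 0` and all fractions. -/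
def IsOfType (ρ ν : ℝ) : Prop :=
  ∃ K : ℝ, 0 < K ∧ ∀ m n : ℤ, n ≠ 0 → K / |(n : ℝ)| ^ (2 + ν) ≤ |ρ - (m : ℝ) / (n : ℝ)|

open scoped Classical in
/-- The minimal type index `ν_ρ ∈ [0, ∞]`. It is `∞` for rational `ρ`, and otherwise the infimum
of the `ν > 0` such that `ρ` is of type `ν` (`∞` if there is none). -/
noncomputable def minimalTypeIndex (ρ : ℝ) : ℝ≥0∞ :=
  if Irrational ρ then ⨅ (ν : ℝ) (_ : 0 < ν ∧ IsOfType ρ ν), ENNReal.ofReal ν else ⊤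

/-- The slope `d₁` of the resonance `α ξ³ = ξ₁³ + α (ξ - ξ₁)³`, `ξ₁ = d₁ ξ`. -/
noncomputable def resonanceD1 (α : ℝ) : ℝ :=
  (-3 * α + Real.sqrt (3 * α * (4 - α))) / (2 * (1 - α))

/-- The slope `d₂` of the resonance `α ξ³ = ξ₁³ + α (ξ - ξ₁)³`, `ξ₁ = d₂ ξ`. -/
noncomputable def resonanceD2 (α : ℝ) : ℝ :=
  (-3 * α - Real.sqrt (3 * α * (4 - α))) / (2 * (1 - α))

/-- `max (ν_{d₁}, ν_{d₂})`. -/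
noncomputable def maxTypeIndex (α : ℝ) : ℝ≥0∞ :=
  max (minimalTypeIndex (resonanceD1 α)) (minimalTypeIndex (resonanceD2 α))

open scoped Classical in
/-- `C₂(lam) = lam ^ (1/2 + max (ν_{d₁}, ν_{d₂}) / 2 + δ)` if the maximum is less than `1`, and
`lam ^ δ` otherwise. -/
noncomputable def constC2 (α δ lam : ℝ) : ℝ :=
  if maxTypeIndex α < 1 then lam ^ (1 / 2 + (maxTypeIndex α).toReal / 2 + δ) else lam ^ δ

/-! ### Distributions on `𝕋_lam × ℝ` and the space-time Fourier transform -/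

/-- The torus `𝕋_lam` of length `2 π lam`, with Lebesgue measure of total mass `2 π lam`. Its
frequencies are `ξ = n / lam`, `n ∈ ℤ`, and `fourier n x = exp (i (n / lam) x)`. -/
abbrev Torus (lam : ℝ) : Type := AddCircle (2 * Real.pi * lam)

/-- A distribution, given by its values on test functions on `𝕋_lam × ℝ`. Only the concrete
distributions built below (a function, and the `x`-derivative of a function) are used. -/
abbrev Functional (lam : ℝ) : Type := (Torus lam × ℝ → ℂ) → ℂ

/-- The distribution `ψ ↦ ∫ w ψ dx dt` of a function `w` on `𝕋_lam × ℝ`. -/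
noncomputable def ofFunction (lam : ℝ) [Fact (0 < 2 * Real.pi * lam)] (w : Torus lam × ℝ → ℂ) :
    Functional lam :=
  fun ψ => ∫ p, w p * ψ p

/-- The distributional derivative in `x`: `⟨∂ₓ F, ψ⟩ = - ⟨F, ∂ₓ ψ⟩`. -/
noncomputable def weakDx {lam : ℝ} (F : Functional lam) : Functional lam :=
  fun ψ => -F (fun p => deriv (fun y : ℝ => ψ (p.1 + (y : Torus lam), p.2)) 0)

/-- The test function `(x, t) ↦ exp (-i (n / lam) x) ∫ exp (-i t τ) φ(τ) dτ`. -/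
noncomputable def fourierTest (lam : ℝ) (n : ℤ) (φ : 𝓢(ℝ, ℂ)) : Torus lam × ℝ → ℂ :=
  fun p => fourier (-n) p.1 * ∫ τ : ℝ, Complex.exp (-(I * p.2 * τ)) * φ τ

/-- The function `(ξ, τ) ↦ U n τ`, `ξ = n / lam`, is the space-time Fourier transform
`∫ ∫ exp (-i (x ξ + t τ)) F dx dt` of `F`, in the sense of (tempered) distributions in `τ`. -/
def IsSpaceTimeFourier {lam : ℝ} (F : Functional lam) (U : ℤ → ℝ → ℂ) : Prop :=
  ∀ (n : ℤ) (φ : 𝓢(ℝ, ℂ)),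
    Integrable (fun τ => U n τ * φ τ) ∧ F (fourierTest lam n φ) = ∫ τ, U n τ * φ τ

/-! ### The norms `X^{s,b}_α`, `Y^s_α`, `Z^s_α` (`α = 1` gives `X^{s,b}`, `Y^s`, `Z^s`) -/

/-- `⟨x⟩ = 1 + |x|`. -/
noncomputable def bracket (x : ℝ) : ℝ := 1 + |x|

/-- `⟨ξ⟩^s ⟨τ - α ξ³⟩^b |U(ξ, τ)|` with `ξ = n / lam`. -/
noncomputable def weighted (lam α s b : ℝ) (U : ℤ → ℝ → ℂ) (n : ℤ) (τ : ℝ) : ℝ≥0∞ :=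
  ENNReal.ofReal (bracket (n / lam) ^ s * bracket (τ - α * (n / lam) ^ 3) ^ b) * ‖U n τ‖ₑ

/-- `‖ ⟨ξ⟩^s ⟨τ - α ξ³⟩^b U ‖` in `L²_{ξ,τ}`, where `ℤ / lam` carries the counting measure
divided by `2 π lam`. -/
noncomputable def normL2L2 (lam α s b : ℝ) (U : ℤ → ℝ → ℂ) : ℝ≥0∞ :=
  (ENNReal.ofReal (1 / (2 * Real.pi * lam)) *
    ∑' n : ℤ, ∫⁻ τ : ℝ, weighted lam α s b U n τ ^ 2) ^ (1 / 2 : ℝ)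

/-- `‖ ⟨ξ⟩^s ⟨τ - α ξ³⟩^b U ‖` in `L²_ξ L¹_τ`, with the same measure on `ℤ / lam`. -/
noncomputable def normL2L1 (lam α s b : ℝ) (U : ℤ → ℝ → ℂ) : ℝ≥0∞ :=
  (ENNReal.ofReal (1 / (2 * Real.pi * lam)) *
    ∑' n : ℤ, (∫⁻ τ : ℝ, weighted lam α s b U n τ) ^ 2) ^ (1 / 2 : ℝ)

/-- `‖F‖_{Y^s_α} = ‖F‖_{X^{s,1/2}_α} + ‖ ⟨ξ⟩^s F̂ ‖_{L²_ξ L¹_τ}`. The Fourier transform `F̂` is unique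
up to null sets, so the infimum is over a single value; it is `∞` if `F̂` is not a function. -/
noncomputable def normY {lam : ℝ} (α s : ℝ) (F : Functional lam) : ℝ≥0∞ :=
  ⨅ (U : ℤ → ℝ → ℂ) (_ : IsSpaceTimeFourier F U),
    normL2L2 lam α s (1 / 2) U + normL2L1 lam α s 0 U

/-- `‖F‖_{Z^s_α} = ‖F‖_{X^{s,-1/2}_α} + ‖ ⟨ξ⟩^s ⟨τ - α ξ³⟩^{-1} F̂ ‖_{L²_ξ L¹_τ}`, with the same
convention. -/
noncomputable def normZ {lam : ℝ} (α s : ℝ) (F : Functional lam) : ℝ≥0∞ :=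
  ⨅ (U : ℤ → ℝ → ℂ) (_ : IsSpaceTimeFourier F U),
    normL2L2 lam α s (-1 / 2) U + normL2L1 lam α s (-1) U

/-- `u ∈ Y^s_α(𝕋_lam × ℝ)`, for `s ≥ 0`, as a space of (classes of) functions: the completion of
the Schwartz class in the `Y^s_α` norm consists of the `L²` functions with finite norm. -/
def MemY (lam : ℝ) [Fact (0 < 2 * Real.pi * lam)] (α s : ℝ) (u : Torus lam × ℝ → ℂ) : Prop :=
  MemLp u 2 volume ∧ normY α s (ofFunction lam u) < ⊤

/-- The mean 0 condition: `∫ u(x, t) dx = 0` for almost every `t`. -/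
def MeanZero (lam : ℝ) [Fact (0 < 2 * Real.pi * lam)] (u : Torus lam × ℝ → ℂ) : Prop :=
  ∀ᵐ t : ℝ, ∫ x : Torus lam, u (x, t) = 0

open scoped FourierTransform

/-! ### The resonance function -/

theorem resonance_factor {α : ℝ} (hα0 : 0 < α) (hα1 : α < 1) (x y : ℝ) :
    y ^ 3 + α * (x - y) ^ 3 - α * x ^ 3 =
      (1 - α) * y * (y - resonanceD1 α * x) * (y - resonanceD2 α * x) := by
  have h1 : (1 - α) ≠ 0 := by linarith
  have hs : Real.sqrt (3 * α * (4 - α)) ^ 2 = 3 * α * (4 - α) :=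
    Real.sq_sqrt (by nlinarith)
  unfold resonanceD1 resonanceD2
  set r := Real.sqrt (3 * α * (4 - α))
  field_simp
  linear_combination (y * x ^ 2) * hs

theorem resonanceD1_pos {α : ℝ} (hα0 : 0 < α) (hα1 : α < 1) : 0 < resonanceD1 α := by
  have h : 3 * α < Real.sqrt (3 * α * (4 - α)) := by
    apply Real.lt_sqrt_of_sq_lt; nlinarith
  unfold resonanceD1
  apply div_pos <;> linarith

theorem resonanceD1_lt_one {α : ℝ} (hα0 : 0 < α) (hα1 : α < 1) : resonanceD1 α < 1 := by
  have h : Real.sqrt (3 * α * (4 - α)) < 2 + α := by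
    rw [Real.sqrt_lt' (by linarith)]; nlinarith [sq_nonneg (1 - α)]
  unfold resonanceD1
  rw [div_lt_one (by linarith)]
  linarith

theorem resonanceD2_neg {α : ℝ} (hα0 : 0 < α) (hα1 : α < 1) : resonanceD2 α < 0 := by
  have h : 0 ≤ Real.sqrt (3 * α * (4 - α)) := Real.sqrt_nonneg _
  unfold resonanceD2
  apply div_neg_of_neg_of_pos <;> linarith

/-! ### Elementary bounds for brackets -/

theorem one_le_bracket (x : ℝ) : 1 ≤ bracket x := by
  unfold bracket; linarith [abs_nonneg x]

theorem bracket_pos (x : ℝ) : 0 < bracket x := lt_of_lt_of_le one_pos (one_le_bracket x)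

theorem bracket_le_two_mul_of_le {x y : ℝ} (h : bracket y ≤ bracket (x - y)) :
    bracket x ≤ 2 * bracket (x - y) := by
  unfold bracket at *
  have : |x| ≤ |y| + |x - y| := by
    calc |x| = |y + (x - y)| := by ring_nf
      _ ≤ _ := abs_add_le _ _
  linarith

/-- The square of `⟨x⟩^s / (⟨y⟩^s ⟨x - y⟩^s)`. -/
noncomputable def weightRatioSq (s x y : ℝ) : ℝ :=
  bracket x ^ (2 * s) * (bracket y ^ (-(2 * s)) * bracket (x - y) ^ (-(2 * s)))

theorem weightRatioSq_nonneg (s x y : ℝ) : 0 ≤ weightRatioSq s x y := by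
  have := bracket_pos x
  have := bracket_pos y
  have := bracket_pos (x - y)
  unfold weightRatioSq; positivity

theorem weightRatioSq_le_left {s x y : ℝ} (hs : 0 ≤ s) (h : bracket y ≤ bracket (x - y)) :
    weightRatioSq s x y ≤ 4 ^ s * bracket y ^ (-(2 * s)) := by
  have hx := bracket_pos x
  have hy := bracket_pos y
  have hz := bracket_pos (x - y)
  have h1 : bracket x ^ (2 * s) ≤ 4 ^ s * bracket (x - y) ^ (2 * s) := by
    calc bracket x ^ (2 * s) ≤ (2 * bracket (x - y)) ^ (2 * s) := by
          gcongr; exact bracket_le_two_mul_of_le h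
      _ = _ := by
          rw [Real.mul_rpow (by norm_num) hz.le, Real.rpow_mul (by norm_num) 2 s]
          norm_num
  unfold weightRatioSq
  calc _ ≤ 4 ^ s * bracket (x - y) ^ (2 * s) *
        (bracket y ^ (-(2 * s)) * bracket (x - y) ^ (-(2 * s))) := by gcongr
    _ = 4 ^ s * bracket y ^ (-(2 * s)) *
        (bracket (x - y) ^ (2 * s) * bracket (x - y) ^ (-(2 * s))) := by ring
    _ = _ := by rw [← Real.rpow_add hz]; simp

theorem weightRatioSq_symm (s x y : ℝ) : weightRatioSq s x (x - y) = weightRatioSq s x y := by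
  unfold weightRatioSq; rw [sub_sub_cancel]; ring

theorem weightRatioSq_le {s : ℝ} (hs : 0 ≤ s) (x y : ℝ) :
    weightRatioSq s x y ≤ 4 ^ s * (bracket y ^ (-(2 * s)) + bracket (x - y) ^ (-(2 * s))) := by
  have hy := bracket_pos y
  have hz := bracket_pos (x - y)
  rcases le_total (bracket y) (bracket (x - y)) with h | h
  · refine (weightRatioSq_le_left hs h).trans ?_
    gcongr
    have : 0 ≤ bracket (x - y) ^ (-(2 * s)) := by positivity
    linarith
  · have := weightRatioSq_le_left (x := x) (y := x - y) hs (by rwa [sub_sub_cancel])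
    rw [weightRatioSq_symm] at this
    refine this.trans ?_
    gcongr
    have : 0 ≤ bracket y ^ (-(2 * s)) := by positivity
    linarith

theorem weightRatioSq_div_le {s : ℝ} (hs : 0 ≤ s) (x : ℝ) {y : ℝ} (hy0 : y ≠ 0) :
    weightRatioSq s x y / |y| ≤
      (4 ^ s + 4 ^ s * 4 ^ s) * (bracket y ^ (-(2 * s)) / |y|) +
        4 ^ s * bracket (x - y) ^ (-(2 * s)) := by
  have hy := bracket_pos y
  have hz := bracket_pos (x - y)
  have hya : 0 < |y| := abs_pos.mpr hy0
  have key : bracket (x - y) ^ (-(2 * s)) / |y| ≤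
      4 ^ s * (bracket y ^ (-(2 * s)) / |y|) + bracket (x - y) ^ (-(2 * s)) := by
    rcases le_total 1 |y| with h | h
    · have h1 : bracket (x - y) ^ (-(2 * s)) / |y| ≤ bracket (x - y) ^ (-(2 * s)) :=
        div_le_self (by positivity) h
      have h2 : 0 ≤ (4 : ℝ) ^ s * (bracket y ^ (-(2 * s)) / |y|) := by positivity
      linarith
    · have h1 : bracket (x - y) ^ (-(2 * s)) ≤ 1 :=
        Real.rpow_le_one_of_one_le_of_nonpos (one_le_bracket _) (by linarith)
      have h2 : 1 ≤ 4 ^ s * bracket y ^ (-(2 * s)) := by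
        have : bracket y ^ (2 * s) ≤ 4 ^ s := by
          calc bracket y ^ (2 * s) ≤ 2 ^ (2 * s) := by
                gcongr; unfold bracket; linarith
            _ = _ := by rw [Real.rpow_mul (by norm_num)]; norm_num
        rw [Real.rpow_neg hy.le, ← div_eq_mul_inv, le_div_iff₀ (by positivity)]
        linarith
      have h3 : 0 ≤ bracket (x - y) ^ (-(2 * s)) := by positivity
      calc _ ≤ (4 ^ s * bracket y ^ (-(2 * s))) / |y| := by gcongr; linarith
        _ ≤ _ := by rw [mul_div_assoc]; linarith
  calc weightRatioSq s x y / |y|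
      ≤ 4 ^ s * (bracket y ^ (-(2 * s)) + bracket (x - y) ^ (-(2 * s))) / |y| := by
        gcongr; exact weightRatioSq_le hs x y
    _ = 4 ^ s * (bracket y ^ (-(2 * s)) / |y|) +
          4 ^ s * (bracket (x - y) ^ (-(2 * s)) / |y|) := by ring
    _ ≤ 4 ^ s * (bracket y ^ (-(2 * s)) / |y|) +
          4 ^ s * (4 ^ s * (bracket y ^ (-(2 * s)) / |y|) + bracket (x - y) ^ (-(2 * s))) := by
        gcongr
    _ = _ := by ring

/-- If `y` and `x - y` are at least comparable to `x`, then the ratio is at most `⟨x⟩^{-2s}`. -/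
theorem weightRatioSq_le_of_comparable {s c x y : ℝ} (hs : 0 ≤ s) (hc0 : 0 < c) (hc1 : c ≤ 1)
    (hy : c * |x| ≤ |y|) (hz : c * |x| ≤ |x - y|) :
    weightRatioSq s x y ≤ (c ^ (-(2 * s))) ^ 2 * bracket x ^ (-(2 * s)) := by
  have hx := bracket_pos x
  have aux : ∀ w : ℝ, c * |x| ≤ |w| →
      bracket w ^ (-(2 * s)) ≤ c ^ (-(2 * s)) * bracket x ^ (-(2 * s)) := by
    intro w hw
    rw [← Real.mul_rpow hc0.le hx.le]
    apply Real.rpow_le_rpow_of_nonpos (by positivity) _ (by linarith)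
    unfold bracket; linarith
  have hby := bracket_pos y
  have hbz := bracket_pos (x - y)
  unfold weightRatioSq
  calc _ ≤ bracket x ^ (2 * s) * ((c ^ (-(2 * s)) * bracket x ^ (-(2 * s))) *
        (c ^ (-(2 * s)) * bracket x ^ (-(2 * s)))) := by
        gcongr
        · exact aux _ hy
        · exact aux _ hz
    _ = (c ^ (-(2 * s))) ^ 2 * bracket x ^ (-(2 * s)) *
        (bracket x ^ (2 * s) * bracket x ^ (-(2 * s))) := by ring
    _ = _ := by rw [← Real.rpow_add hx]; simp

/-! ### Sums over the frequencies `n / lam` -/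

/-- The summable majorant `(1 + |k|) ^ (-(1 + θ))` on the integers. -/
noncomputable def intDecay (θ : ℝ) (k : ℤ) : ℝ := bracket k ^ (-(1 + θ))

theorem intDecay_nonneg (θ : ℝ) (k : ℤ) : 0 ≤ intDecay θ k :=
  Real.rpow_nonneg (bracket_pos _).le _

theorem summable_intDecay {θ : ℝ} (hθ : 0 < θ) : Summable (intDecay θ) := by
  have h : Summable fun k : ℤ => |(k : ℝ)| ^ (-(1 + θ)) :=
    Real.summable_abs_int_rpow (by linarith)
  refine Summable.of_norm_bounded_eventually h ?_
  rw [Filter.eventually_cofinite]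
  refine (Set.finite_singleton (0 : ℤ)).subset ?_
  intro k hk
  by_contra hk0
  apply hk
  rw [Real.norm_of_nonneg (intDecay_nonneg _ _)]
  have : 0 < |(k : ℝ)| := abs_pos.mpr (Int.cast_ne_zero.mpr hk0)
  apply Real.rpow_le_rpow_of_nonpos this _ (by linarith)
  unfold bracket; linarith

theorem bracket_le_lam_mul {lam : ℝ} (hl : 1 ≤ lam) (k : ℤ) :
    bracket k ≤ lam * bracket (k / lam) := by
  have : 0 < lam := by linarith
  unfold bracket
  rw [abs_div, abs_of_pos this, mul_add, mul_div_cancel₀ _ this.ne']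
  linarith

theorem bracket_rpow_neg_le {lam r : ℝ} (hl : 1 ≤ lam) (hr : 0 ≤ r) (k : ℤ) :
    bracket (k / lam) ^ (-r) ≤ lam ^ r * bracket k ^ (-r) := by
  have h0 : 0 < lam := by linarith
  have hb := bracket_pos (k / lam)
  have h1 : (lam * bracket (k / lam)) ^ (-r) ≤ bracket k ^ (-r) :=
    Real.rpow_le_rpow_of_nonpos (bracket_pos _) (bracket_le_lam_mul hl k) (by linarith)
  rw [Real.mul_rpow h0.le hb.le, Real.rpow_neg h0.le] at h1
  rwa [inv_mul_le_iff₀ (by positivity)] at h1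

theorem bracket_rpow_neg_div_lam_le {lam p θ : ℝ} (hl : 1 ≤ lam) (hθ : 0 < θ) (hp : 1 + θ ≤ p)
    (k : ℤ) : bracket (k / lam) ^ (-p) / lam ≤ lam ^ θ * intDecay θ k := by
  have h0 : 0 < lam := by linarith
  rw [div_le_iff₀ h0]
  calc bracket (k / lam) ^ (-p) ≤ bracket (k / lam) ^ (-(1 + θ)) :=
        Real.rpow_le_rpow_of_exponent_le (one_le_bracket _) (by linarith)
    _ ≤ lam ^ (1 + θ) * bracket k ^ (-(1 + θ)) := bracket_rpow_neg_le hl (by linarith) k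
    _ = _ := by unfold intDecay; rw [Real.rpow_add h0, Real.rpow_one]; ring

theorem bracket_rpow_neg_div_abs_le {lam p θ : ℝ} (hl : 1 ≤ lam) (hθ : 0 < θ) (hp : θ ≤ p)
    {k : ℤ} (hk : k ≠ 0) :
    bracket (k / lam) ^ (-p) / |(k / lam : ℝ)| / lam ≤ 2 * (lam ^ θ * intDecay θ k) := by
  have h0 : 0 < lam := by linarith
  have hk1 : 1 ≤ |(k : ℝ)| := by exact_mod_cast Int.one_le_abs hk
  have hb := bracket_pos (k : ℝ)
  have hb2 := bracket_pos (k / lam : ℝ)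
  have e : bracket (k / lam) ^ (-p) / |(k / lam : ℝ)| / lam =
      bracket (k / lam) ^ (-p) / |(k : ℝ)| := by
    rw [abs_div, abs_of_pos h0]; field_simp
  rw [e, div_le_iff₀ (by linarith)]
  have h2 : 1 ≤ bracket (k : ℝ) ^ (-1 : ℝ) * (2 * |(k : ℝ)|) := by
    rw [Real.rpow_neg_one, ← div_eq_inv_mul, le_div_iff₀ hb]
    unfold bracket; linarith
  have h3 : 0 ≤ lam ^ θ * bracket (k : ℝ) ^ (-θ) := by positivity
  calc bracket (k / lam) ^ (-p) ≤ bracket (k / lam) ^ (-θ) :=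
        Real.rpow_le_rpow_of_exponent_le (one_le_bracket _) (by linarith)
    _ ≤ lam ^ θ * bracket k ^ (-θ) := bracket_rpow_neg_le hl (by linarith) k
    _ ≤ lam ^ θ * bracket k ^ (-θ) * (bracket (k : ℝ) ^ (-1 : ℝ) * (2 * |(k : ℝ)|)) :=
        le_mul_of_one_le_right h3 h2
    _ = _ := by
        unfold intDecay
        rw [show (-(1 + θ)) = -θ + -1 by ring, Real.rpow_add hb]; ring

/-! ### The multiplier -/

/-- The resonance function `ξ₁³ + α (ξ - ξ₁)³ - α ξ³`. -/
noncomputable def resonance (α x y : ℝ) : ℝ := y ^ 3 + α * (x - y) ^ 3 - α * x ^ 3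

/-- The square of the multiplier `|ξ| ⟨ξ⟩^s ⟨ξ₁⟩^{-s} ⟨ξ - ξ₁⟩^{-s} (1 + |H|)^{-1/2}`. -/
noncomputable def multiplierSq (α s x y : ℝ) : ℝ :=
  x ^ 2 * weightRatioSq s x y / (1 + |resonance α x y|)

theorem abs_resonance {α : ℝ} (hα0 : 0 < α) (hα1 : α < 1) (x y : ℝ) :
    |resonance α x y| =
      (1 - α) * |y| * |y - resonanceD1 α * x| * |y - resonanceD2 α * x| := by
  unfold resonance
  rw [resonance_factor hα0 hα1, abs_mul, abs_mul, abs_mul, abs_of_pos (by linarith : 0 < 1 - α)]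

/-- A constant separating `0, 1, d₁, d₂`. -/
theorem exists_separation {α : ℝ} (hα0 : 0 < α) (hα1 : α < 1) :
    ∃ c : ℝ, 0 < c ∧ c ≤ 1 ∧
      (2 * c ≤ |resonanceD1 α| ∧ 2 * c ≤ |1 - resonanceD1 α|) ∧
      (2 * c ≤ |resonanceD2 α| ∧ 2 * c ≤ |1 - resonanceD2 α|) ∧
      2 * c ≤ |resonanceD1 α - resonanceD2 α| := by
  have h1 := resonanceD1_pos hα0 hα1
  have h2 := resonanceD1_lt_one hα0 hα1
  have h3 := resonanceD2_neg hα0 hα1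
  set d := resonanceD1 α
  set e := resonanceD2 α
  refine ⟨min (min d (1 - d)) (-e) / 2, ?_, ?_, ⟨?_, ?_⟩, ⟨?_, ?_⟩, ?_⟩
  · have : 0 < min (min d (1 - d)) (-e) := by
      refine lt_min (lt_min h1 ?_) ?_ <;> linarith
    linarith
  all_goals
    have a1 : min (min d (1 - d)) (-e) ≤ d := (min_le_left _ _).trans (min_le_left _ _)
    have a2 : min (min d (1 - d)) (-e) ≤ 1 - d := (min_le_left _ _).trans (min_le_right _ _)
    have a3 : min (min d (1 - d)) (-e) ≤ -e := min_le_right _ _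
  · linarith
  · rw [abs_of_pos h1]; linarith
  · rw [abs_of_pos (by linarith)]; linarith
  · rw [abs_of_neg h3]; linarith
  · rw [abs_of_pos (by linarith)]; linarith
  · rw [abs_of_pos (by linarith)]; linarith

/-- Away from the resonant slopes the multiplier is controlled by `|ξ₁|^{-1}`. -/
theorem multiplierSq_le_of_nonresonant {α c s x y : ℝ} (hα0 : 0 < α) (hα1 : α < 1) (hc : 0 < c)
    (hy : y ≠ 0) (h1 : c * |x| ≤ |y - resonanceD1 α * x|)
    (h2 : c * |x| ≤ |y - resonanceD2 α * x|) :
    multiplierSq α s x y ≤ ((1 - α) * c ^ 2)⁻¹ * (weightRatioSq s x y / |y|) := by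
  have hya : 0 < |y| := abs_pos.mpr hy
  have hw := weightRatioSq_nonneg s x y
  have ha : 0 < 1 - α := by linarith
  have hH : (1 - α) * c ^ 2 * |y| * x ^ 2 ≤ |resonance α x y| := by
    rw [abs_resonance hα0 hα1, ← sq_abs x]
    calc (1 - α) * c ^ 2 * |y| * |x| ^ 2 = (1 - α) * |y| * (c * |x|) * (c * |x|) := by ring
      _ ≤ _ := by gcongr
  unfold multiplierSq
  rw [div_le_iff₀ (by positivity), ← div_eq_inv_mul, div_div, div_mul_eq_mul_div,
    le_div_iff₀ (by positivity)]
  calc x ^ 2 * weightRatioSq s x y * (|y| * ((1 - α) * c ^ 2))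
      = weightRatioSq s x y * ((1 - α) * c ^ 2 * |y| * x ^ 2) := by ring
    _ ≤ weightRatioSq s x y * (1 + |resonance α x y|) := by gcongr; linarith

/-- Near a resonant slope `d` the multiplier is controlled by the distance to resonance. -/
theorem multiplierSq_le_of_resonant {α c s x y d e : ℝ} (hs : 0 ≤ s) (hα1 : α < 1)
    (hc : 0 < c) (hc1 : c ≤ 1)
    (hH : |resonance α x y| = (1 - α) * |y| * |y - d * x| * |y - e * x|)
    (hd0 : 2 * c ≤ |d|) (hd1 : 2 * c ≤ |1 - d|) (hde : 2 * c ≤ |d - e|)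
    (h : |y - d * x| ≤ c * |x|) :
    multiplierSq α s x y ≤ (c ^ (-(2 * s))) ^ 2 *
      (bracket x ^ (-(2 * s)) * x ^ 2 / (1 + (1 - α) * c ^ 2 * x ^ 2 * |y - d * x|)) := by
  have ha : 0 < 1 - α := by linarith
  have hx0 := abs_nonneg x
  have aux : ∀ f w : ℝ, 2 * c ≤ |f| → |w| = |f * x + (y - d * x)| → c * |x| ≤ |w| := by
    intro f w hf hw
    have h3 : |f * x| ≤ |w| + |y - d * x| := by
      rw [hw]
      calc |f * x| = |(f * x + (y - d * x)) - (y - d * x)| := by ring_nf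
        _ ≤ _ := abs_sub _ _
    rw [abs_mul] at h3
    nlinarith
  have hy : c * |x| ≤ |y| := aux d y hd0 (by ring_nf)
  have hz : c * |x| ≤ |x - y| := aux (-(1 - d)) (x - y) (by rwa [abs_neg]) (by
    rw [← abs_neg]; ring_nf)
  have hw : c * |x| ≤ |y - e * x| := aux (d - e) _ hde (by ring_nf)
  have hH' : (1 - α) * c ^ 2 * x ^ 2 * |y - d * x| ≤ |resonance α x y| := by
    rw [hH, ← sq_abs x]
    calc _ = (1 - α) * (c * |x|) * |y - d * x| * (c * |x|) := by ring
      _ ≤ _ := by gcongr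
  have hb := bracket_pos x
  unfold multiplierSq
  calc _ ≤ x ^ 2 * ((c ^ (-(2 * s))) ^ 2 * bracket x ^ (-(2 * s))) /
        (1 + (1 - α) * c ^ 2 * x ^ 2 * |y - d * x|) := by
        gcongr
        exact weightRatioSq_le_of_comparable hs hc hc1 hy hz
    _ = _ := by ring

/-- The lower bound for `|m - d n|` needed close to resonance: none if `s ≥ 1`, and a type
condition on `d` otherwise. -/
def ResonanceGap (d s lam K D : ℝ) : Prop :=
  1 ≤ s ∨ ∃ μ : ℝ, 0 ≤ μ ∧ 1 + μ ≤ 2 * s ∧ lam ^ (1 + μ) ≤ D ∧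
    ∀ m n : ℤ, n ≠ 0 → K * |(n : ℝ)| ^ (-(1 + μ)) ≤ |(m : ℝ) - d * n|

theorem near_resonance_bound {d s lam K D κ : ℝ} (hl : 1 ≤ lam)
    (hK0 : 0 < K) (hK1 : K ≤ 1) (hκ0 : 0 < κ) (hκ1 : κ ≤ 1) (hD : 1 ≤ D)
    (hgap : ResonanceGap d s lam K D) (m : ℤ) {n : ℤ} (hn : n ≠ 0) :
    bracket (n / lam) ^ (-(2 * s)) * (n / lam : ℝ) ^ 2 /
      (1 + κ * (n / lam : ℝ) ^ 2 * |(m / lam : ℝ) - d * (n / lam)|) / lam ≤ (κ * K)⁻¹ * D := by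
  have h0 : 0 < lam := by linarith
  set x : ℝ := n / lam with hx
  have hb := bracket_pos x
  have hκK : κ * K ≤ 1 := mul_le_one₀ hκ1 hK0.le hK1
  have hinv : 1 ≤ (κ * K)⁻¹ := (one_le_inv₀ (by positivity)).mpr hκK
  have hn0 : 0 < |(n : ℝ)| := abs_pos.mpr (Int.cast_ne_zero.mpr hn)
  have hxne : x ≠ 0 := div_ne_zero (Int.cast_ne_zero.mpr hn) h0.ne'
  have hx0 : 0 < x ^ 2 := by positivity
  rcases hgap with h1 | ⟨μ, hμ0, hμs, hμD, hgap⟩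
  · have hA : bracket x ^ (-(2 * s)) * x ^ 2 ≤ 1 := by
      have h3 : x ^ 2 ≤ bracket x ^ (2 * s) := by
        calc x ^ 2 = |x| ^ 2 := (sq_abs x).symm
          _ ≤ bracket x ^ 2 := by gcongr; unfold bracket; linarith
          _ = bracket x ^ (2 : ℝ) := by norm_cast
          _ ≤ _ := Real.rpow_le_rpow_of_exponent_le (one_le_bracket _) (by linarith)
      rw [Real.rpow_neg hb.le, inv_mul_le_iff₀ (by positivity), mul_one]
      exact h3
    calc _ ≤ bracket x ^ (-(2 * s)) * x ^ 2 / 1 / 1 := by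
          gcongr
          have : 0 ≤ κ * x ^ 2 * |(m / lam : ℝ) - d * x| := by positivity
          linarith
      _ ≤ 1 := by simpa using hA
      _ ≤ _ := one_le_mul_of_one_le_of_one_le hinv hD
  · have hz := hgap m n hn
    have hzeq : |(m / lam : ℝ) - d * x| = |(m : ℝ) - d * n| / lam := by
      rw [← abs_of_pos h0, ← abs_div, abs_of_pos h0, hx]; congr 1; field_simp
    have hzpos : 0 < |(m : ℝ) - d * n| := lt_of_lt_of_le (by positivity) hz
    rw [hzeq]
    have hnx : |(n : ℝ)| ≤ lam * bracket x := by
      have := bracket_le_lam_mul hl n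
      unfold bracket at this ⊢; linarith
    have hbig : bracket x ^ (-(2 * s)) * |(n : ℝ)| ^ (1 + μ) ≤ D := by
      calc _ ≤ bracket x ^ (-(2 * s)) * (lam * bracket x) ^ (1 + μ) := by gcongr
        _ = lam ^ (1 + μ) * (bracket x ^ (-(2 * s)) * bracket x ^ (1 + μ)) := by
            rw [Real.mul_rpow h0.le hb.le]; ring
        _ = lam ^ (1 + μ) * bracket x ^ (-(2 * s) + (1 + μ)) := by
            rw [Real.rpow_add hb (-(2 * s)) (1 + μ)]
        _ ≤ lam ^ (1 + μ) * 1 := by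
            gcongr
            exact Real.rpow_le_one_of_one_le_of_nonpos (one_le_bracket _) (by linarith)
        _ ≤ D := by linarith
    calc _ ≤ bracket x ^ (-(2 * s)) * x ^ 2 / (κ * x ^ 2 * (|(m : ℝ) - d * n| / lam)) / lam := by
          gcongr; linarith
      _ = κ⁻¹ * (bracket x ^ (-(2 * s)) * |(m : ℝ) - d * n|⁻¹) := by field_simp
      _ ≤ κ⁻¹ * (bracket x ^ (-(2 * s)) * (K * |(n : ℝ)| ^ (-(1 + μ)))⁻¹) := by gcongr
      _ = (κ * K)⁻¹ * (bracket x ^ (-(2 * s)) * |(n : ℝ)| ^ (1 + μ)) := by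
          rw [Real.rpow_neg hn0.le, mul_inv, mul_inv, inv_inv]; ring
      _ ≤ _ := by gcongr

theorem far_resonance_bound {d s lam θ c κ : ℝ} (hl : 1 ≤ lam) (hθ0 : 0 < θ) (hθ1 : θ ≤ 1)
    (hθs : θ ≤ 2 * s) (hc1 : c ≤ 1) (hκ0 : 0 < κ) {m n : ℤ} (hn : n ≠ 0)
    (hz1 : 1 ≤ |(m : ℝ) - d * n|) (hzn : |(m : ℝ) - d * n| ≤ c * |(n : ℝ)|) :
    bracket (n / lam) ^ (-(2 * s)) * (n / lam : ℝ) ^ 2 /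
      (1 + κ * (n / lam : ℝ) ^ 2 * |(m / lam : ℝ) - d * (n / lam)|) / lam ≤
        κ⁻¹ * 9 * (lam ^ θ * intDecay θ (m - ⌊d * n⌋)) := by
  have h0 : 0 < lam := by linarith
  set x : ℝ := n / lam with hx
  have hb := bracket_pos x
  have hxne : x ≠ 0 := div_ne_zero (Int.cast_ne_zero.mpr hn) h0.ne'
  have hx0 : 0 < x ^ 2 := by positivity
  have hzeq : |(m / lam : ℝ) - d * x| = |(m : ℝ) - d * n| / lam := by
    rw [← abs_of_pos h0, ← abs_div, abs_of_pos h0, hx]; congr 1; field_simp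
  rw [hzeq]
  set z := |(m : ℝ) - d * n| with hzdef
  have hz0 : 0 < z := by linarith
  have hzb : z ≤ lam * bracket x := by
    have := bracket_le_lam_mul hl n
    have h3 : c * |(n : ℝ)| ≤ |(n : ℝ)| := mul_le_of_le_one_left (abs_nonneg _) hc1
    unfold bracket at this ⊢; linarith
  have h3 : bracket ((m - ⌊d * n⌋ : ℤ) : ℝ) ≤ 3 * z := by
    have f1 := Int.floor_le (d * n)
    have f2 := Int.lt_floor_add_one (d * n)
    have : |((m - ⌊d * n⌋ : ℤ) : ℝ)| ≤ z + 1 := by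
      push_cast
      calc |(m : ℝ) - ⌊d * n⌋| = |((m : ℝ) - d * n) + (d * n - ⌊d * n⌋)| := by ring_nf
        _ ≤ |(m : ℝ) - d * n| + |d * n - ⌊d * n⌋| := abs_add_le _ _
        _ ≤ z + 1 := by
          rw [abs_of_nonneg (by linarith : 0 ≤ d * n - ⌊d * n⌋)]; linarith
    unfold bracket; linarith
  have h4 : z ^ (-(1 + θ)) ≤ 9 * intDecay θ (m - ⌊d * n⌋) := by
    have h5 : (3 * z) ^ (-(1 + θ)) ≤ intDecay θ (m - ⌊d * n⌋) :=
      Real.rpow_le_rpow_of_nonpos (bracket_pos _) h3 (by linarith)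
    rw [Real.mul_rpow (by norm_num) hz0.le, Real.rpow_neg (by norm_num : (0 : ℝ) ≤ 3),
      inv_mul_le_iff₀ (by positivity)] at h5
    have h6 : (3 : ℝ) ^ (1 + θ) ≤ 9 := by
      calc (3 : ℝ) ^ (1 + θ) ≤ 3 ^ (2 : ℝ) := by
            apply Real.rpow_le_rpow_of_exponent_le <;> linarith
        _ = 9 := by norm_num
    exact h5.trans (by gcongr; exact intDecay_nonneg _ _)
  have h5 : bracket x ^ (-(2 * s)) * z⁻¹ ≤ lam ^ θ * z ^ (-(1 + θ)) := by
    have e : z⁻¹ = z ^ θ * z ^ (-(1 + θ)) := by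
      rw [← Real.rpow_add hz0, ← Real.rpow_neg_one]; congr 1; ring
    calc bracket x ^ (-(2 * s)) * z⁻¹
        = bracket x ^ (-(2 * s)) * z ^ θ * z ^ (-(1 + θ)) := by rw [e]; ring
      _ ≤ bracket x ^ (-(2 * s)) * (lam * bracket x) ^ θ * z ^ (-(1 + θ)) := by gcongr
      _ = lam ^ θ * bracket x ^ (-(2 * s) + θ) * z ^ (-(1 + θ)) := by
          rw [Real.mul_rpow h0.le hb.le, Real.rpow_add hb]; ring
      _ ≤ lam ^ θ * 1 * z ^ (-(1 + θ)) := by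
          gcongr
          exact Real.rpow_le_one_of_one_le_of_nonpos (one_le_bracket _) (by linarith)
      _ = _ := by ring
  calc _ ≤ bracket x ^ (-(2 * s)) * x ^ 2 / (κ * x ^ 2 * (z / lam)) / lam := by
        gcongr; linarith
    _ = κ⁻¹ * (bracket x ^ (-(2 * s)) * z⁻¹) := by field_simp
    _ ≤ κ⁻¹ * (lam ^ θ * (9 * intDecay θ (m - ⌊d * n⌋))) := by
        refine mul_le_mul_of_nonneg_left (h5.trans ?_) (by positivity)
        gcongr
    _ = _ := by ring

theorem resonance_bound {d s lam K D θ c κ : ℝ} (hl : 1 ≤ lam) (hθ0 : 0 < θ) (hθ1 : θ ≤ 1)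
    (hθs : θ ≤ 2 * s) (hc1 : c ≤ 1) (hK0 : 0 < K) (hK1 : K ≤ 1) (hκ0 : 0 < κ)
    (hκ1 : κ ≤ 1) (hD : 1 ≤ D) (hDθ : lam ^ θ ≤ D) (hgap : ResonanceGap d s lam K D) {m n : ℤ}
    (hn : n ≠ 0) (hzn : |(m / lam : ℝ) - d * (n / lam)| ≤ c * |(n / lam : ℝ)|) :
    bracket (n / lam) ^ (-(2 * s)) * (n / lam : ℝ) ^ 2 /
      (1 + κ * (n / lam : ℝ) ^ 2 * |(m / lam : ℝ) - d * (n / lam)|) / lam ≤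
        (κ * K)⁻¹ * 9 * D * intDecay θ (m - ⌊d * n⌋) := by
  have h0 : 0 < lam := by linarith
  have hI := intDecay_nonneg θ (m - ⌊d * n⌋)
  have hKi : 1 ≤ K⁻¹ := (one_le_inv₀ hK0).mpr hK1
  rcases le_or_gt 1 |(m : ℝ) - d * n| with h | h
  · have hzn' : |(m : ℝ) - d * n| ≤ c * |(n : ℝ)| := by
      have e : (m / lam : ℝ) - d * (n / lam) = ((m : ℝ) - d * n) / lam := by field_simp
      rw [e, abs_div, abs_div, abs_of_pos h0, ← mul_div_assoc] at hzn
      exact (div_le_div_iff_of_pos_right h0).mp hzn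
    refine (far_resonance_bound hl hθ0 hθ1 hθs hc1 hκ0 hn h hzn').trans ?_
    calc κ⁻¹ * 9 * (lam ^ θ * intDecay θ (m - ⌊d * n⌋))
        ≤ κ⁻¹ * 9 * (D * intDecay θ (m - ⌊d * n⌋)) := by gcongr
      _ = 1 * (κ⁻¹ * 9 * (D * intDecay θ (m - ⌊d * n⌋))) := by ring
      _ ≤ K⁻¹ * (κ⁻¹ * 9 * (D * intDecay θ (m - ⌊d * n⌋))) := by
          gcongr
      _ = _ := by rw [mul_inv]; ring
  · have hk : |((m - ⌊d * n⌋ : ℤ) : ℝ)| ≤ 1 := by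
      have f1 := Int.floor_le (d * n)
      have f2 := Int.lt_floor_add_one (d * n)
      have h1 := abs_lt.mp h
      have : |m - ⌊d * n⌋| ≤ 1 := by
        rw [abs_le]
        constructor
        · have : (-2 : ℝ) < ((m - ⌊d * n⌋ : ℤ) : ℝ) := by push_cast; linarith
          have : -2 < m - ⌊d * n⌋ := by exact_mod_cast this
          omega
        · have : ((m - ⌊d * n⌋ : ℤ) : ℝ) < 2 := by push_cast; linarith
          have : m - ⌊d * n⌋ < 2 := by exact_mod_cast this
          omega
      exact_mod_cast this
    have hP : 1 ≤ 9 * intDecay θ (m - ⌊d * n⌋) := by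
      have h2 : (2 : ℝ) ^ (-(2 : ℝ)) ≤ intDecay θ (m - ⌊d * n⌋) := by
        calc (2 : ℝ) ^ (-(2 : ℝ)) ≤ 2 ^ (-(1 + θ)) := by
              apply Real.rpow_le_rpow_of_exponent_le <;> linarith
          _ ≤ _ := by
              apply Real.rpow_le_rpow_of_nonpos (bracket_pos _) _ (by linarith)
              unfold bracket; linarith
      have h3 : (2 : ℝ) ^ (-(2 : ℝ)) = 1 / 4 := by
        rw [Real.rpow_neg (by norm_num)]; norm_num
      rw [h3] at h2
      linarith
    refine (near_resonance_bound hl hK0 hK1 hκ0 hκ1 hD hgap m hn).trans ?_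
    calc (κ * K)⁻¹ * D = (κ * K)⁻¹ * D * 1 := by ring
      _ ≤ (κ * K)⁻¹ * D * (9 * intDecay θ (m - ⌊d * n⌋)) := by gcongr
      _ = _ := by ring

/-- The majorant of the multiplier: decay away from four integers depending on `n`. -/
noncomputable def majorant (α θ : ℝ) (n m : ℤ) : ℝ :=
  intDecay θ m + intDecay θ (n - m) +
    intDecay θ (m - ⌊resonanceD1 α * n⌋) + intDecay θ (m - ⌊resonanceD2 α * n⌋)

theorem multiplierSq_le_majorant {α s θ K : ℝ} (hα0 : 0 < α) (hα1 : α < 1) (hθ0 : 0 < θ)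
    (hθ1 : θ ≤ 1) (hθs : 1 + θ ≤ 2 * s) (hK0 : 0 < K) (hK1 : K ≤ 1) :
    ∃ C : ℝ, 0 < C ∧ ∀ lam D : ℝ, 1 ≤ lam → lam ^ θ ≤ D →
      ResonanceGap (resonanceD1 α) s lam K D → ResonanceGap (resonanceD2 α) s lam K D →
      ∀ n m : ℤ, m ≠ 0 →
        multiplierSq α s (n / lam) (m / lam) / lam ≤ C * D * majorant α θ n m := by
  obtain ⟨c, hc0, hc1, ⟨h10, h11⟩, ⟨h20, h21⟩, h12⟩ := exists_separation hα0 hα1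
  have ha : 0 < 1 - α := by linarith
  set κ := (1 - α) * c ^ 2 with hκ
  have hκ0 : 0 < κ := by positivity
  have hκ1 : κ ≤ 1 := by
    have : c ^ 2 ≤ 1 := pow_le_one₀ hc0.le hc1
    exact mul_le_one₀ (by linarith) (by positivity) this
  set C1 := (c ^ (-(2 * s))) ^ 2 * ((κ * K)⁻¹ * 9)
  set C2 : ℝ := κ⁻¹ * ((4 ^ s + 4 ^ s * 4 ^ s) * 2 + 4 ^ s)
  have hC1 : 0 < C1 := by positivity
  have hC2 : 0 < C2 := by positivity
  refine ⟨C1 + C2, by positivity, ?_⟩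
  intro lam D hl hDθ hg1 hg2 n m hm
  have h0 : 0 < lam := by linarith
  have hD : 1 ≤ D := (Real.one_le_rpow hl hθ0.le).trans hDθ
  have hD0 : 0 < D := by linarith
  have p1 := intDecay_nonneg θ m
  have p2 := intDecay_nonneg θ (n - m)
  have p3 := intDecay_nonneg θ (m - ⌊resonanceD1 α * n⌋)
  have p4 := intDecay_nonneg θ (m - ⌊resonanceD2 α * n⌋)
  have hH := abs_resonance hα0 hα1 (n / lam) (m / lam)
  have hm0 : (m / lam : ℝ) ≠ 0 := div_ne_zero (Int.cast_ne_zero.mpr hm) h0.ne'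
  by_cases hn : n = 0
  · have : multiplierSq α s (n / lam) (m / lam) = 0 := by simp [multiplierSq, hn]
    rw [this, zero_div]
    unfold majorant
    positivity
  by_cases hr1 : |(m / lam : ℝ) - resonanceD1 α * (n / lam)| ≤ c * |(n / lam : ℝ)|
  · have hb := multiplierSq_le_of_resonant (s := s) (by linarith) hα1 hc0 hc1 hH h10 h11 h12 hr1
    calc _ ≤ _ := div_le_div_of_nonneg_right hb h0.le
      _ ≤ C1 * D * intDecay θ (m - ⌊resonanceD1 α * n⌋) := by
        rw [mul_div_assoc]
        refine (mul_le_mul_of_nonneg_left (resonance_bound hl hθ0 hθ1 (by linarith) hc1 hK0 hK1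
          hκ0 hκ1 hD hDθ hg1 hn hr1) (by positivity)).trans (le_of_eq ?_)
        ring
      _ ≤ _ := by
        unfold majorant
        gcongr <;> linarith
  by_cases hr2 : |(m / lam : ℝ) - resonanceD2 α * (n / lam)| ≤ c * |(n / lam : ℝ)|
  · have hb := multiplierSq_le_of_resonant (s := s) (e := resonanceD1 α) (by linarith) hα1 hc0 hc1
      (by rw [hH]; ring) h20 h21 (by rwa [abs_sub_comm]) hr2
    calc _ ≤ _ := div_le_div_of_nonneg_right hb h0.le
      _ ≤ C1 * D * intDecay θ (m - ⌊resonanceD2 α * n⌋) := by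
        rw [mul_div_assoc]
        refine (mul_le_mul_of_nonneg_left (resonance_bound hl hθ0 hθ1 (by linarith) hc1 hK0 hK1
          hκ0 hκ1 hD hDθ hg2 hn hr2) (by positivity)).trans (le_of_eq ?_)
        ring
      _ ≤ _ := by
        unfold majorant
        gcongr <;> linarith
  · push Not at hr1 hr2
    have hb := multiplierSq_le_of_nonresonant (s := s) hα0 hα1 hc0 hm0 hr1.le hr2.le
    have hw := weightRatioSq_div_le (s := s) (by linarith) (n / lam) hm0
    have hw1 := bracket_rpow_neg_div_abs_le (p := 2 * s) hl hθ0 (by linarith) hm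
    have hw2 := bracket_rpow_neg_div_lam_le (p := 2 * s) hl hθ0 hθs (n - m)
    have hsub : (n / lam : ℝ) - m / lam = ((n - m : ℤ) : ℝ) / lam := by push_cast; ring
    rw [hsub] at hw
    calc _ ≤ κ⁻¹ * (weightRatioSq s (n / lam) (m / lam) / |(m / lam : ℝ)|) / lam :=
          div_le_div_of_nonneg_right hb h0.le
      _ ≤ κ⁻¹ * ((4 ^ s + 4 ^ s * 4 ^ s) *
            (bracket (m / lam) ^ (-(2 * s)) / |(m / lam : ℝ)|) +
          4 ^ s * bracket (((n - m : ℤ) : ℝ) / lam) ^ (-(2 * s))) / lam := by gcongr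
      _ = κ⁻¹ * ((4 ^ s + 4 ^ s * 4 ^ s) *
            (bracket (m / lam) ^ (-(2 * s)) / |(m / lam : ℝ)| / lam) +
          4 ^ s * (bracket (((n - m : ℤ) : ℝ) / lam) ^ (-(2 * s)) / lam)) := by ring
      _ ≤ κ⁻¹ * ((4 ^ s + 4 ^ s * 4 ^ s) * (2 * (lam ^ θ * intDecay θ m)) +
          4 ^ s * (lam ^ θ * intDecay θ (n - m))) := by gcongr
      _ ≤ κ⁻¹ * ((4 ^ s + 4 ^ s * 4 ^ s) * (2 * (D * (intDecay θ m + intDecay θ (n - m)))) +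
          4 ^ s * (D * (intDecay θ m + intDecay θ (n - m)))) := by gcongr <;> linarith
      _ = C2 * D * (intDecay θ m + intDecay θ (n - m)) := by ring
      _ ≤ _ := by
        exact mul_le_mul (mul_le_mul_of_nonneg_right (by linarith) hD0.le)
          (by unfold majorant; linarith) (by positivity) (by positivity)

theorem tsum_ofReal_majorant (α θ : ℝ) (n : ℤ) :
    ∑' m : ℤ, ENNReal.ofReal (majorant α θ n m) =
      4 * ∑' m : ℤ, ENNReal.ofReal (intDecay θ m) := by
  have e : ∀ m : ℤ, ENNReal.ofReal (majorant α θ n m) =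
      ENNReal.ofReal (intDecay θ m) + ENNReal.ofReal (intDecay θ (n - m)) +
        ENNReal.ofReal (intDecay θ (m - ⌊resonanceD1 α * n⌋)) +
        ENNReal.ofReal (intDecay θ (m - ⌊resonanceD2 α * n⌋)) := by
    intro m
    have p1 := intDecay_nonneg θ m
    have p2 := intDecay_nonneg θ (n - m)
    have p3 := intDecay_nonneg θ (m - ⌊resonanceD1 α * n⌋)
    have p4 := intDecay_nonneg θ (m - ⌊resonanceD2 α * n⌋)
    unfold majorant
    rw [ENNReal.ofReal_add (by positivity) p4, ENNReal.ofReal_add (by positivity) p3,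
      ENNReal.ofReal_add p1 p2]
  simp_rw [e]
  rw [ENNReal.tsum_add, ENNReal.tsum_add, ENNReal.tsum_add]
  have r : ∀ k : ℤ, ∑' m : ℤ, ENNReal.ofReal (intDecay θ (m - k)) =
      ∑' m : ℤ, ENNReal.ofReal (intDecay θ m) := fun k =>
    (Equiv.subRight k).tsum_eq (fun m => ENNReal.ofReal (intDecay θ m))
  have l : ∑' m : ℤ, ENNReal.ofReal (intDecay θ (n - m)) =
      ∑' m : ℤ, ENNReal.ofReal (intDecay θ m) :=
    (Equiv.subLeft n).tsum_eq (fun m => ENNReal.ofReal (intDecay θ m))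
  rw [r, r, l]
  ring

/-! ### Type conditions -/

theorem IsOfType.mono {ρ ν μ : ℝ} (h : IsOfType ρ ν) (hνμ : ν ≤ μ) : IsOfType ρ μ := by
  obtain ⟨K, hK, h⟩ := h
  refine ⟨K, hK, fun m n hn => le_trans ?_ (h m n hn)⟩
  have : 1 ≤ |(n : ℝ)| := by exact_mod_cast Int.one_le_abs hn
  gcongr

theorem isOfType_of_minimalTypeIndex_lt {ρ μ : ℝ} (h : minimalTypeIndex ρ < ENNReal.ofReal μ) :
    IsOfType ρ μ := by
  unfold minimalTypeIndex at h
  split_ifs at h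
  · simp only [iInf_lt_iff] at h
    obtain ⟨ν, ⟨hν, hν'⟩, hlt⟩ := h
    have : 0 < μ := by
      by_contra hμ
      rw [ENNReal.ofReal_of_nonpos (not_lt.mp hμ)] at hlt
      exact not_lt_bot hlt
    exact hν'.mono (le_of_lt ((ENNReal.ofReal_lt_ofReal_iff this).mp hlt))
  · exact absurd h (not_lt.mpr le_top)

theorem IsOfType.exists_gap {ρ μ : ℝ} (h : IsOfType ρ μ) :
    ∃ K : ℝ, 0 < K ∧ ∀ m n : ℤ, n ≠ 0 → K * |(n : ℝ)| ^ (-(1 + μ)) ≤ |(m : ℝ) - ρ * n| := by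
  obtain ⟨K, hK, h⟩ := h
  refine ⟨K, hK, fun m n hn => ?_⟩
  have hn' : (n : ℝ) ≠ 0 := Int.cast_ne_zero.mpr hn
  have hn0 : 0 < |(n : ℝ)| := abs_pos.mpr hn'
  have e : |(m : ℝ) - ρ * n| = |ρ - m / n| * |(n : ℝ)| := by
    rw [← abs_mul, ← abs_neg]; congr 1; field_simp; ring
  rw [e]
  calc K * |(n : ℝ)| ^ (-(1 + μ)) = K / |(n : ℝ)| ^ (2 + μ) * |(n : ℝ)| := by
        rw [show (2 + μ) = (1 + μ) + 1 by ring, Real.rpow_add hn0, Real.rpow_one,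
          Real.rpow_neg hn0.le]
        field_simp
    _ ≤ _ := by gcongr; exact h m n hn

theorem half_lt_of_threshold {ν : ℝ≥0∞} {s ε : ℝ} (hε : 0 < ε)
    (hs : min 1 (1 / 2 + ν / 2 + ENNReal.ofReal ε) ≤ ENNReal.ofReal s) : 1 / 2 < s := by
  have h : ENNReal.ofReal (1 / 2) < ENNReal.ofReal s := by
    refine lt_of_lt_of_le ?_ hs
    have e : ENNReal.ofReal (1 / 2) = 1 / 2 := by
      rw [ENNReal.ofReal_div_of_pos (by norm_num)]; simp
    rw [e]
    refine lt_min ?_ ?_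
    · rw [← e]
      rw [show (1 : ℝ≥0∞) = ENNReal.ofReal 1 by simp]
      exact (ENNReal.ofReal_lt_ofReal_iff one_pos).mpr (by norm_num)
    · have : (1 / 2 : ℝ≥0∞) < 1 / 2 + ENNReal.ofReal ε := by
        apply ENNReal.lt_add_right
        · simp
        · simpa using hε
      refine this.trans_le ?_
      gcongr
      exact le_self_add
  exact (ENNReal.ofReal_lt_ofReal_iff_of_nonneg (by norm_num)).mp h

/-- The gap condition with constant `C₂(lam)²`. -/
theorem exists_resonanceGap {α s ε δ : ℝ} (hε : 0 < ε) (hδ : 0 < δ)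
    (hs : min 1 (1 / 2 + maxTypeIndex α / 2 + ENNReal.ofReal ε) ≤ ENNReal.ofReal s) :
    ∃ K : ℝ, 0 < K ∧ K ≤ 1 ∧ ∀ lam : ℝ, 1 ≤ lam →
      ResonanceGap (resonanceD1 α) s lam K (constC2 α δ lam ^ 2) ∧
      ResonanceGap (resonanceD2 α) s lam K (constC2 α δ lam ^ 2) := by
  by_cases h1 : 1 ≤ s
  · exact ⟨1, one_pos, le_rfl, fun lam _ => ⟨Or.inl h1, Or.inl h1⟩⟩
  push Not at h1
  have hs0 : 0 < s := by linarith [half_lt_of_threshold hε hs]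
  have hs' : 1 / 2 + maxTypeIndex α / 2 + ENNReal.ofReal ε ≤ ENNReal.ofReal s := by
    rcases min_le_iff.mp hs with h | h
    · exact absurd (ENNReal.one_le_ofReal.mp h) (not_le.mpr h1)
    · exact h
  have hfin : maxTypeIndex α ≠ ⊤ := by
    intro h
    rw [h] at hs'
    simp [ENNReal.top_div] at hs'
  set ν := (maxTypeIndex α).toReal with hν
  have hν0 : 0 ≤ ν := ENNReal.toReal_nonneg
  have hνeq : maxTypeIndex α = ENNReal.ofReal ν := (ENNReal.ofReal_toReal hfin).symm
  have hsr : 1 / 2 + ν / 2 + ε ≤ s := by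
    have e : ENNReal.ofReal (1 / 2 + ν / 2 + ε) =
        1 / 2 + maxTypeIndex α / 2 + ENNReal.ofReal ε := by
      rw [ENNReal.ofReal_add (by positivity) hε.le, ENNReal.ofReal_add (by positivity)
        (by positivity), ENNReal.ofReal_div_of_pos (by norm_num),
        ENNReal.ofReal_div_of_pos (by norm_num), hνeq]
      simp
    rw [← e] at hs'
    exact (ENNReal.ofReal_le_ofReal_iff hs0.le).mp hs'
  have hν1 : maxTypeIndex α < 1 := by
    rw [hνeq, show (1 : ℝ≥0∞) = ENNReal.ofReal 1 by simp]
    exact (ENNReal.ofReal_lt_ofReal_iff one_pos).mpr (by linarith)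
  set η := min ε δ
  have hη : 0 < η := lt_min hε hδ
  have hηε : η ≤ ε := min_le_left _ _
  have hηδ : η ≤ δ := min_le_right _ _
  have hlt : maxTypeIndex α < ENNReal.ofReal (ν + 2 * η) := by
    rw [hνeq]
    exact (ENNReal.ofReal_lt_ofReal_iff (by positivity)).mpr (by linarith)
  obtain ⟨K1, hK1, g1⟩ :=
    (isOfType_of_minimalTypeIndex_lt ((le_max_left _ _).trans_lt hlt)).exists_gap
  obtain ⟨K2, hK2, g2⟩ :=
    (isOfType_of_minimalTypeIndex_lt ((le_max_right _ _).trans_lt hlt)).exists_gap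
  refine ⟨min 1 (min K1 K2), lt_min one_pos (lt_min hK1 hK2), min_le_left _ _, ?_⟩
  intro lam hl
  have h0 : 0 < lam := by linarith
  have hD : lam ^ (1 + (ν + 2 * η)) ≤ constC2 α δ lam ^ 2 := by
    unfold constC2
    rw [if_pos hν1, ← Real.rpow_natCast, ← Real.rpow_mul h0.le]
    apply Real.rpow_le_rpow_of_exponent_le hl
    push_cast
    linarith
  refine ⟨Or.inr ⟨ν + 2 * η, by positivity, by linarith, hD, fun m n hn => ?_⟩,
    Or.inr ⟨ν + 2 * η, by positivity, by linarith, hD, fun m n hn => ?_⟩⟩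
  · refine le_trans ?_ (g1 m n hn)
    gcongr
    exact (min_le_right _ _).trans (min_le_left _ _)
  · refine le_trans ?_ (g2 m n hn)
    gcongr
    exact (min_le_right _ _).trans (min_le_right _ _)

theorem rpow_le_constC2 {α δ lam : ℝ} (hl : 1 ≤ lam) : lam ^ δ ≤ constC2 α δ lam := by
  unfold constC2
  split_ifs
  · apply Real.rpow_le_rpow_of_exponent_le hl
    have : 0 ≤ (maxTypeIndex α).toReal := ENNReal.toReal_nonneg
    linarith
  · exact le_rfl

theorem constC2_pos {α δ lam : ℝ} (hl : 1 ≤ lam) : 0 < constC2 α δ lam :=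
  lt_of_lt_of_le (Real.rpow_pos_of_pos (by linarith) _) (rpow_le_constC2 hl)

/-- The bound for the multiplier in `L^∞_ξ L²_{ξ₁}`, without the frequency `ξ₁ = 0`. -/
theorem exists_tsum_multiplierSq_le {α s ε δ : ℝ} (hα0 : 0 < α) (hα1 : α < 1) (hε : 0 < ε)
    (hδ : 0 < δ)
    (hs : min 1 (1 / 2 + maxTypeIndex α / 2 + ENNReal.ofReal ε) ≤ ENNReal.ofReal s) :
    ∃ C : ℝ, 0 < C ∧ ∀ lam : ℝ, 1 ≤ lam → ∀ n : ℤ,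
      ∑' m : ℤ, (if m = 0 then 0 else
        ENNReal.ofReal (multiplierSq α s (n / lam) (m / lam) / lam)) ≤
          ENNReal.ofReal (C * constC2 α δ lam ^ 2) := by
  have hs2 := half_lt_of_threshold hε hs
  set θ := min (2 * δ) (min 1 (2 * s - 1))
  have hθ0 : 0 < θ := lt_min (by linarith) (lt_min one_pos (by linarith))
  have hθδ : θ ≤ 2 * δ := min_le_left _ _
  have hθ1 : θ ≤ 1 := (min_le_right _ _).trans (min_le_left _ _)
  have hθs : θ ≤ 2 * s - 1 := (min_le_right _ _).trans (min_le_right _ _)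
  obtain ⟨K, hK0, hK1, hgap⟩ := exists_resonanceGap hε hδ hs
  obtain ⟨C, hC, hb⟩ := multiplierSq_le_majorant (s := s) hα0 hα1 hθ0 hθ1 (by linarith) hK0 hK1
  have hsum := summable_intDecay hθ0
  set S := ∑' m : ℤ, intDecay θ m
  have hS : ∑' m : ℤ, ENNReal.ofReal (intDecay θ m) = ENNReal.ofReal S :=
    (ENNReal.ofReal_tsum_of_nonneg (intDecay_nonneg θ) hsum).symm
  have hS0 : 0 ≤ S := tsum_nonneg (intDecay_nonneg θ)
  refine ⟨C * (4 * S) + 1, by positivity, ?_⟩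
  intro lam hl n
  have h0 : 0 < lam := by linarith
  have hc := constC2_pos (α := α) (δ := δ) hl
  have hD : lam ^ θ ≤ constC2 α δ lam ^ 2 := by
    calc lam ^ θ ≤ lam ^ (2 * δ) := Real.rpow_le_rpow_of_exponent_le hl hθδ
      _ = (lam ^ δ) ^ 2 := by
        rw [← Real.rpow_natCast, ← Real.rpow_mul h0.le]; congr 1; push_cast; ring
      _ ≤ _ := by gcongr; exact rpow_le_constC2 hl
  calc _ ≤ ∑' m : ℤ, ENNReal.ofReal (C * constC2 α δ lam ^ 2) *
        ENNReal.ofReal (majorant α θ n m) := by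
        refine ENNReal.tsum_le_tsum fun m => ?_
        split_ifs with hm
        · exact zero_le
        · rw [← ENNReal.ofReal_mul (by positivity)]
          exact ENNReal.ofReal_le_ofReal (hb lam _ hl hD (hgap lam hl).1 (hgap lam hl).2 n m hm)
    _ = ENNReal.ofReal (C * constC2 α δ lam ^ 2) * (4 * ENNReal.ofReal S) := by
        rw [ENNReal.tsum_mul_left, tsum_ofReal_majorant, hS]
    _ = ENNReal.ofReal (C * constC2 α δ lam ^ 2 * (4 * S)) := by
        rw [ENNReal.ofReal_mul (p := C * constC2 α δ lam ^ 2) (by positivity),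
          ENNReal.ofReal_mul (p := 4) (by norm_num)]
        simp
    _ ≤ _ := by
        apply ENNReal.ofReal_le_ofReal
        nlinarith [sq_nonneg (constC2 α δ lam)]

/-! ### Cauchy-Schwarz and Young inequalities for `ℝ≥0∞`-valued functions -/

theorem lintegral_mul_sq_le {X : Type*} [MeasurableSpace X] {μ : Measure X} {f g : X → ℝ≥0∞}
    (hf : AEMeasurable f μ) (hg : AEMeasurable g μ) :
    (∫⁻ x, f x * g x ∂μ) ^ 2 ≤ (∫⁻ x, f x ^ 2 ∂μ) * ∫⁻ x, g x ^ 2 ∂μ := by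
  have h := ENNReal.lintegral_mul_le_Lp_mul_Lq μ Real.HolderConjugate.two_two hf hg
  calc (∫⁻ x, f x * g x ∂μ) ^ 2
      ≤ ((∫⁻ x, f x ^ (2 : ℝ) ∂μ) ^ (1 / 2 : ℝ) * (∫⁻ x, g x ^ (2 : ℝ) ∂μ) ^ (1 / 2 : ℝ)) ^ 2 := by
        gcongr
        exact h
    _ = _ := by
        rw [mul_pow, ← ENNReal.rpow_natCast, ← ENNReal.rpow_natCast, ← ENNReal.rpow_mul,
          ← ENNReal.rpow_mul]
        norm_num

theorem ENNReal.tsum_mul_sq_le {ι : Type*} (f g : ι → ℝ≥0∞) :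
    (∑' i, f i * g i) ^ 2 ≤ (∑' i, f i ^ 2) * ∑' i, g i ^ 2 := by
  let _ : MeasurableSpace ι := ⊤
  have h := lintegral_mul_sq_le (μ := Measure.count) (f := f) (g := g)
    (measurable_from_top).aemeasurable (measurable_from_top).aemeasurable
  simpa [lintegral_count' measurable_from_top] using h

theorem ENNReal.add_add_sq_le (a b c : ℝ≥0∞) :
    (a + b + c) ^ 2 ≤ 3 * (a ^ 2 + b ^ 2 + c ^ 2) := by
  have h := ENNReal.tsum_mul_sq_le (ι := Fin 3) (fun _ => 1) ![a, b, c]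
  simpa [tsum_fintype, Fin.sum_univ_three] using h

/-- The convolution of two `ℝ≥0∞`-valued functions on the line. -/
noncomputable def lconv (f g : ℝ → ℝ≥0∞) (τ : ℝ) : ℝ≥0∞ := ∫⁻ x, f x * g (τ - x)

theorem measurable_lconv {f g : ℝ → ℝ≥0∞} (hf : Measurable f) (hg : Measurable g) :
    Measurable (lconv f g) := by
  unfold lconv
  apply Measurable.lintegral_prod_right'
    (f := fun p : ℝ × ℝ => f p.2 * g (p.1 - p.2))
  fun_prop

theorem lconv_comm (f g : ℝ → ℝ≥0∞) : lconv f g = lconv g f := by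
  ext τ
  unfold lconv
  rw [← lintegral_sub_left_eq_self _ τ]
  simp [mul_comm]

theorem lconv_const_mul {c : ℝ≥0∞} (hc : c ≠ ⊤) (f g : ℝ → ℝ≥0∞) (τ : ℝ) :
    lconv (fun x => c * f x) g τ = c * lconv f g τ := by
  unfold lconv
  rw [← lintegral_const_mul' _ _ hc]
  simp only [mul_assoc]

theorem lintegral_lconv {f g : ℝ → ℝ≥0∞} (hf : Measurable f) (hg : Measurable g) :
    ∫⁻ τ, lconv f g τ = (∫⁻ x, f x) * ∫⁻ x, g x := by
  unfold lconv
  rw [lintegral_lintegral_swap (by fun_prop)]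
  have : ∀ x, ∫⁻ τ, f x * g (τ - x) = f x * ∫⁻ y, g y := by
    intro x
    rw [lintegral_const_mul _ (by fun_prop), lintegral_sub_right_eq_self (fun τ => g τ) x]
  simp_rw [this]
  rw [lintegral_mul_const _ hf]

theorem lintegral_lconv_sq_le {f g : ℝ → ℝ≥0∞} (hf : Measurable f) (hg : Measurable g) :
    ∫⁻ τ, lconv f g τ ^ 2 ≤ (∫⁻ x, f x) ^ 2 * ∫⁻ x, g x ^ 2 := by
  have key : ∀ τ, lconv f g τ ^ 2 ≤ (∫⁻ x, f x) * lconv f (fun y => g y ^ 2) τ := by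
    intro τ
    have h := lintegral_mul_sq_le (μ := (volume : Measure ℝ).withDensity f) (f := fun _ => 1)
      (g := fun x => g (τ - x)) (by fun_prop) (by fun_prop)
    rw [lintegral_withDensity_eq_lintegral_mul _ hf (by fun_prop),
      lintegral_withDensity_eq_lintegral_mul _ hf (by fun_prop),
      lintegral_withDensity_eq_lintegral_mul _ hf (by fun_prop)] at h
    simpa [lconv] using h
  calc _ ≤ ∫⁻ τ, (∫⁻ x, f x) * lconv f (fun y => g y ^ 2) τ := lintegral_mono key
    _ = _ := by
      rw [lintegral_const_mul _ (measurable_lconv hf (by fun_prop)),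
        lintegral_lconv hf (by fun_prop)]
      ring

theorem lintegral_lconv_sq_le' {f g : ℝ → ℝ≥0∞} (hf : Measurable f) (hg : Measurable g) :
    ∫⁻ τ, lconv f g τ ^ 2 ≤ (∫⁻ x, f x ^ 2) * (∫⁻ x, g x) ^ 2 := by
  rw [lconv_comm, mul_comm]
  exact lintegral_lconv_sq_le hg hf

/-! ### The modulation weights -/

/-- `⟨τ - c⟩ ^ b` as an extended nonnegative real. -/
noncomputable def modWeight (c b τ : ℝ) : ℝ≥0∞ := ENNReal.ofReal (bracket (τ - c) ^ b)

theorem measurable_modWeight (c b : ℝ) : Measurable (modWeight c b) := by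
  unfold modWeight bracket
  fun_prop

theorem modWeight_add (c a b τ : ℝ) : modWeight c (a + b) τ = modWeight c a τ * modWeight c b τ := by
  have := bracket_pos (τ - c)
  unfold modWeight
  rw [Real.rpow_add this, ENNReal.ofReal_mul (by positivity)]

theorem modWeight_zero (c τ : ℝ) : modWeight c 0 τ = 1 := by simp [modWeight]

theorem modWeight_le_one {b : ℝ} (hb : b ≤ 0) (c τ : ℝ) : modWeight c b τ ≤ 1 :=
  ENNReal.ofReal_le_one.mpr (Real.rpow_le_one_of_one_le_of_nonpos (one_le_bracket _) hb)

theorem one_le_modWeight {b : ℝ} (hb : 0 ≤ b) (c τ : ℝ) : 1 ≤ modWeight c b τ :=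
  ENNReal.one_le_ofReal.mpr (Real.one_le_rpow (one_le_bracket _) hb)

/-- `∫ ⟨τ⟩^{-2} dτ`. -/
noncomputable def modConst : ℝ≥0∞ := ∫⁻ τ, modWeight 0 (-2) τ

theorem modConst_lt_top : modConst < ⊤ := by
  have h : Integrable (fun x : ℝ => (1 + ‖x‖) ^ (-2 : ℝ)) :=
    integrable_one_add_norm (by simp)
  have := h.lintegral_lt_top
  simpa [modConst, modWeight, bracket] using this

theorem lintegral_modWeight_sq (c : ℝ) : ∫⁻ τ, modWeight c (-1) τ ^ 2 = modConst := by
  have : ∀ τ, modWeight c (-1) τ ^ 2 = modWeight 0 (-2) (τ - c) := by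
    intro τ
    rw [sq, ← modWeight_add]
    norm_num [modWeight]
  simp_rw [this]
  rw [lintegral_sub_right_eq_self (fun τ => modWeight 0 (-2) τ) c]
  rfl

/-- `(1 + |c₁ + c₂ - c|)^{1/2}` is at most the sum of the three modulation weights. -/
theorem resonance_le_modWeights (c c₁ c₂ τ x : ℝ) :
    1 ≤ ENNReal.ofReal ((1 + |c₁ + c₂ - c|) ^ (-(1 / 2) : ℝ)) *
      (modWeight c (1 / 2) τ + modWeight c₁ (1 / 2) x + modWeight c₂ (1 / 2) (τ - x)) := by
  have h0 : 0 < 1 + |c₁ + c₂ - c| := by positivity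
  have b1 := bracket_pos (τ - c)
  have b2 := bracket_pos (x - c₁)
  have b3 := bracket_pos (τ - x - c₂)
  have h1 : 1 + |c₁ + c₂ - c| ≤ bracket (τ - c) + bracket (x - c₁) + bracket (τ - x - c₂) := by
    unfold bracket
    have : |c₁ + c₂ - c| ≤ |τ - c| + |x - c₁| + |τ - x - c₂| := by
      calc |c₁ + c₂ - c| = |(τ - c) - (x - c₁) - (τ - x - c₂)| := by ring_nf
        _ ≤ |(τ - c) - (x - c₁)| + |τ - x - c₂| := abs_sub _ _
        _ ≤ _ := by gcongr; exact abs_sub _ _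
    linarith
  have h2 : (1 + |c₁ + c₂ - c|) ^ (1 / 2 : ℝ) ≤ bracket (τ - c) ^ (1 / 2 : ℝ) +
      bracket (x - c₁) ^ (1 / 2 : ℝ) + bracket (τ - x - c₂) ^ (1 / 2 : ℝ) := by
    calc _ ≤ (bracket (τ - c) + bracket (x - c₁) + bracket (τ - x - c₂)) ^ (1 / 2 : ℝ) := by
          gcongr
      _ ≤ (bracket (τ - c) + bracket (x - c₁)) ^ (1 / 2 : ℝ) +
          bracket (τ - x - c₂) ^ (1 / 2 : ℝ) :=
          Real.rpow_add_le_add_rpow (by positivity) b3.le (by norm_num) (by norm_num)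
      _ ≤ _ := by
          gcongr
          exact Real.rpow_add_le_add_rpow b1.le b2.le (by norm_num) (by norm_num)
  unfold modWeight
  rw [← ENNReal.ofReal_add (by positivity) (by positivity),
    ← ENNReal.ofReal_add (by positivity) (by positivity), ← ENNReal.ofReal_mul (by positivity),
    ENNReal.one_le_ofReal, Real.rpow_neg h0.le, ← div_eq_inv_mul, one_le_div (by positivity)]
  exact h2

theorem lconv_le_modWeights (c c₁ c₂ : ℝ) {f g : ℝ → ℝ≥0∞} (hf : Measurable f)
    (hg : Measurable g) (τ : ℝ) :
    lconv f g τ ≤ ENNReal.ofReal ((1 + |c₁ + c₂ - c|) ^ (-(1 / 2) : ℝ)) *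
      (modWeight c (1 / 2) τ * lconv f g τ + lconv (fun x => modWeight c₁ (1 / 2) x * f x) g τ +
        lconv f (fun x => modWeight c₂ (1 / 2) x * g x) τ) := by
  have m1 := measurable_modWeight c₁ (1 / 2)
  have m2 := measurable_modWeight c₂ (1 / 2)
  set q := ENNReal.ofReal ((1 + |c₁ + c₂ - c|) ^ (-(1 / 2) : ℝ))
  unfold lconv
  rw [← lintegral_const_mul _ (by fun_prop), ← lintegral_add_left (by fun_prop),
    ← lintegral_add_left (by fun_prop), ← lintegral_const_mul _ (by fun_prop)]
  refine lintegral_mono fun x => ?_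
  calc f x * g (τ - x) = 1 * (f x * g (τ - x)) := (one_mul _).symm
    _ ≤ (q * (modWeight c (1 / 2) τ + modWeight c₁ (1 / 2) x + modWeight c₂ (1 / 2) (τ - x))) *
        (f x * g (τ - x)) := by
        gcongr
        exact resonance_le_modWeights c c₁ c₂ τ x
    _ = _ := by ring

/-- `(∫ f)² + ∫ (⟨τ - c⟩^{1/2} f)²`. -/
noncomputable def fiberNormSq (c : ℝ) (f : ℝ → ℝ≥0∞) : ℝ≥0∞ :=
  (∫⁻ x, f x) ^ 2 + ∫⁻ x, (modWeight c (1 / 2) x * f x) ^ 2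

/-- The three terms of the convolution after one of the modulation weights has been used. -/
noncomputable def modSum (c₁ c₂ : ℝ) (f g : ℝ → ℝ≥0∞) (τ : ℝ) : ℝ≥0∞ :=
  lconv f g τ + lconv (fun x => modWeight c₁ (1 / 2) x * f x) g τ +
    lconv f (fun x => modWeight c₂ (1 / 2) x * g x) τ

section
variable {f g : ℝ → ℝ≥0∞}

theorem measurable_modSum (hf : Measurable f) (hg : Measurable g) (c₁ c₂ : ℝ) :
    Measurable (modSum c₁ c₂ f g) := by
  have m1 := measurable_modWeight c₁ (1 / 2)
  have m2 := measurable_modWeight c₂ (1 / 2)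
  unfold modSum
  exact ((measurable_lconv hf hg).add (measurable_lconv (by fun_prop) hg)).add
    (measurable_lconv hf (by fun_prop))

theorem lintegral_lconv_sq_le_fiberNormSq (hf : Measurable f) (hg : Measurable g) (c₁ c₂ : ℝ) :
    ∫⁻ τ, lconv f g τ ^ 2 ≤ fiberNormSq c₁ f * fiberNormSq c₂ g := by
  refine (lintegral_lconv_sq_le hf hg).trans ?_
  unfold fiberNormSq
  refine mul_le_mul' le_self_add (le_trans ?_ le_add_self)
  refine lintegral_mono fun x => ?_
  gcongr
  exact le_mul_of_one_le_left' (one_le_modWeight (by norm_num) _ _)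

theorem lintegral_lconv_left_sq_le_fiberNormSq (hf : Measurable f) (hg : Measurable g)
    (c₁ c₂ : ℝ) :
    ∫⁻ τ, lconv (fun x => modWeight c₁ (1 / 2) x * f x) g τ ^ 2 ≤
      fiberNormSq c₁ f * fiberNormSq c₂ g := by
  have m1 := measurable_modWeight c₁ (1 / 2)
  refine (lintegral_lconv_sq_le' (by fun_prop) hg).trans ?_
  exact mul_le_mul' le_add_self le_self_add

theorem lintegral_lconv_right_sq_le_fiberNormSq (hf : Measurable f) (hg : Measurable g)
    (c₁ c₂ : ℝ) :
    ∫⁻ τ, lconv f (fun x => modWeight c₂ (1 / 2) x * g x) τ ^ 2 ≤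
      fiberNormSq c₁ f * fiberNormSq c₂ g := by
  have m1 := measurable_modWeight c₂ (1 / 2)
  refine (lintegral_lconv_sq_le hf (by fun_prop)).trans ?_
  exact mul_le_mul' le_self_add le_add_self

theorem lintegral_modSum_sq_le (hf : Measurable f) (hg : Measurable g) (c₁ c₂ : ℝ) :
    ∫⁻ τ, modSum c₁ c₂ f g τ ^ 2 ≤ 9 * (fiberNormSq c₁ f * fiberNormSq c₂ g) := by
  have m1 := measurable_modWeight c₁ (1 / 2)
  have m2 := measurable_modWeight c₂ (1 / 2)
  have n1 := measurable_lconv hf hg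
  have n2 := measurable_lconv (f := fun x => modWeight c₁ (1 / 2) x * f x) (by fun_prop) hg
  have n3 := measurable_lconv (g := fun x => modWeight c₂ (1 / 2) x * g x) hf (by fun_prop)
  calc _ ≤ ∫⁻ τ, 3 * (lconv f g τ ^ 2 + lconv (fun x => modWeight c₁ (1 / 2) x * f x) g τ ^ 2 +
        lconv f (fun x => modWeight c₂ (1 / 2) x * g x) τ ^ 2) :=
        lintegral_mono fun τ => ENNReal.add_add_sq_le _ _ _
    _ = 3 * ((∫⁻ τ, lconv f g τ ^ 2) +
          (∫⁻ τ, lconv (fun x => modWeight c₁ (1 / 2) x * f x) g τ ^ 2) +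
          (∫⁻ τ, lconv f (fun x => modWeight c₂ (1 / 2) x * g x) τ ^ 2)) := by
        rw [lintegral_const_mul _ (by fun_prop), lintegral_add_left (by fun_prop),
          lintegral_add_left (by fun_prop)]
    _ ≤ 3 * (fiberNormSq c₁ f * fiberNormSq c₂ g + fiberNormSq c₁ f * fiberNormSq c₂ g +
          fiberNormSq c₁ f * fiberNormSq c₂ g) := by
        gcongr
        · exact lintegral_lconv_sq_le_fiberNormSq hf hg c₁ c₂
        · exact lintegral_lconv_left_sq_le_fiberNormSq hf hg c₁ c₂
        · exact lintegral_lconv_right_sq_le_fiberNormSq hf hg c₁ c₂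
    _ = _ := by ring

theorem modWeight_mul_lconv_le (hf : Measurable f) (hg : Measurable g) (c c₁ c₂ τ : ℝ) :
    modWeight c (-1 / 2) τ * lconv f g τ ≤
      ENNReal.ofReal ((1 + |c₁ + c₂ - c|) ^ (-(1 / 2) : ℝ)) * modSum c₁ c₂ f g τ := by
  have hle : modWeight c (-1 / 2) τ ≤ 1 := modWeight_le_one (by norm_num) _ _
  have hinv : modWeight c (-1 / 2) τ * modWeight c (1 / 2) τ = 1 := by
    rw [← modWeight_add]; norm_num [modWeight_zero]
  set q := ENNReal.ofReal ((1 + |c₁ + c₂ - c|) ^ (-(1 / 2) : ℝ))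
  set w := modWeight c (-1 / 2) τ
  calc w * lconv f g τ ≤ w * (q * (modWeight c (1 / 2) τ * lconv f g τ +
        lconv (fun x => modWeight c₁ (1 / 2) x * f x) g τ +
        lconv f (fun x => modWeight c₂ (1 / 2) x * g x) τ)) := by
        gcongr
        exact lconv_le_modWeights c c₁ c₂ hf hg τ
    _ = q * ((w * modWeight c (1 / 2) τ) * lconv f g τ +
        w * lconv (fun x => modWeight c₁ (1 / 2) x * f x) g τ +
        w * lconv f (fun x => modWeight c₂ (1 / 2) x * g x) τ) := by ring
    _ ≤ q * (1 * lconv f g τ +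
        1 * lconv (fun x => modWeight c₁ (1 / 2) x * f x) g τ +
        1 * lconv f (fun x => modWeight c₂ (1 / 2) x * g x) τ) := by
        gcongr
        exact hinv.le
    _ = _ := by unfold modSum; ring

theorem lintegral_modWeight_mul_lconv_sq_le (hf : Measurable f) (hg : Measurable g)
    (c c₁ c₂ : ℝ) :
    (∫⁻ τ, modWeight c (-1) τ * lconv f g τ) ^ 2 ≤
      ENNReal.ofReal ((1 + |c₁ + c₂ - c|) ^ (-(1 / 2) : ℝ)) ^ 2 *
        (9 * (1 + modConst) * (fiberNormSq c₁ f * fiberNormSq c₂ g)) := by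
  have m1 := measurable_modWeight c₁ (1 / 2)
  have m2 := measurable_modWeight c₂ (1 / 2)
  have m3 := measurable_modWeight c (-1)
  have n1 := measurable_lconv hf hg
  have n2 := measurable_lconv (f := fun x => modWeight c₁ (1 / 2) x * f x) (by fun_prop) hg
  have n3 := measurable_lconv (g := fun x => modWeight c₂ (1 / 2) x * g x) hf (by fun_prop)
  set q := ENNReal.ofReal ((1 + |c₁ + c₂ - c|) ^ (-(1 / 2) : ℝ))
  set N := fiberNormSq c₁ f * fiberNormSq c₂ g
  have pt : ∀ τ, modWeight c (-1) τ * lconv f g τ ≤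
      q * (lconv f g τ + modWeight c (-1) τ * lconv (fun x => modWeight c₁ (1 / 2) x * f x) g τ +
        modWeight c (-1) τ * lconv f (fun x => modWeight c₂ (1 / 2) x * g x) τ) := by
    intro τ
    have hle : modWeight c (-1) τ * modWeight c (1 / 2) τ ≤ 1 := by
      rw [← modWeight_add]; exact modWeight_le_one (by norm_num) _ _
    calc _ ≤ modWeight c (-1) τ * (q * (modWeight c (1 / 2) τ * lconv f g τ +
          lconv (fun x => modWeight c₁ (1 / 2) x * f x) g τ +
          lconv f (fun x => modWeight c₂ (1 / 2) x * g x) τ)) := by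
          gcongr
          exact lconv_le_modWeights c c₁ c₂ hf hg τ
      _ = q * ((modWeight c (-1) τ * modWeight c (1 / 2) τ) * lconv f g τ +
          modWeight c (-1) τ * lconv (fun x => modWeight c₁ (1 / 2) x * f x) g τ +
          modWeight c (-1) τ * lconv f (fun x => modWeight c₂ (1 / 2) x * g x) τ) := by ring
      _ ≤ q * (1 * lconv f g τ +
          modWeight c (-1) τ * lconv (fun x => modWeight c₁ (1 / 2) x * f x) g τ +
          modWeight c (-1) τ * lconv f (fun x => modWeight c₂ (1 / 2) x * g x) τ) := by
          gcongr
      _ = _ := by rw [one_mul]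
  have i1 : (∫⁻ τ, lconv f g τ) ^ 2 ≤ N := by
    rw [lintegral_lconv hf hg, mul_pow]
    exact mul_le_mul' le_self_add le_self_add
  have i2 : (∫⁻ τ, modWeight c (-1) τ * lconv (fun x => modWeight c₁ (1 / 2) x * f x) g τ) ^ 2 ≤
      modConst * N := by
    refine (lintegral_mul_sq_le m3.aemeasurable n2.aemeasurable).trans ?_
    rw [lintegral_modWeight_sq]
    gcongr
    exact lintegral_lconv_left_sq_le_fiberNormSq hf hg c₁ c₂
  have i3 : (∫⁻ τ, modWeight c (-1) τ * lconv f (fun x => modWeight c₂ (1 / 2) x * g x) τ) ^ 2 ≤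
      modConst * N := by
    refine (lintegral_mul_sq_le m3.aemeasurable n3.aemeasurable).trans ?_
    rw [lintegral_modWeight_sq]
    gcongr
    exact lintegral_lconv_right_sq_le_fiberNormSq hf hg c₁ c₂
  calc _ ≤ (∫⁻ τ, q * (lconv f g τ +
        modWeight c (-1) τ * lconv (fun x => modWeight c₁ (1 / 2) x * f x) g τ +
        modWeight c (-1) τ * lconv f (fun x => modWeight c₂ (1 / 2) x * g x) τ)) ^ 2 := by
        gcongr ?_ ^ 2
        exact lintegral_mono pt
    _ = q ^ 2 * ((∫⁻ τ, lconv f g τ) +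
        (∫⁻ τ, modWeight c (-1) τ * lconv (fun x => modWeight c₁ (1 / 2) x * f x) g τ) +
        (∫⁻ τ, modWeight c (-1) τ * lconv f (fun x => modWeight c₂ (1 / 2) x * g x) τ)) ^ 2 := by
        rw [lintegral_const_mul _ (by fun_prop), lintegral_add_left (by fun_prop),
          lintegral_add_left (by fun_prop), mul_pow]
    _ ≤ q ^ 2 * (3 * (N + modConst * N + modConst * N)) := by
        gcongr
        refine (ENNReal.add_add_sq_le _ _ _).trans ?_
        gcongr
    _ ≤ q ^ 2 * (3 * (N + modConst * N + modConst * N) +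
          (6 * N + 3 * (modConst * N))) := by gcongr; exact le_self_add
    _ = _ := by ring

end

/-! ### The bilinear estimate on the Fourier side -/

theorem ENNReal.rpow_half_sq (x : ℝ≥0∞) : (x ^ (1 / 2 : ℝ)) ^ 2 = x := by
  rw [← ENNReal.rpow_natCast, ← ENNReal.rpow_mul]; norm_num

theorem ENNReal.sq_rpow_half (x : ℝ≥0∞) : (x ^ 2) ^ (1 / 2 : ℝ) = x := by
  rw [← ENNReal.rpow_natCast, ← ENNReal.rpow_mul]; norm_num

/-- `⟨n / lam⟩^s`. -/
noncomputable def freqWeight (lam s : ℝ) (n : ℤ) : ℝ≥0∞ := ENNReal.ofReal (bracket (n / lam) ^ s)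

theorem weighted_eq (lam α s b : ℝ) (U : ℤ → ℝ → ℂ) (n : ℤ) (τ : ℝ) :
    weighted lam α s b U n τ =
      modWeight (α * (n / lam) ^ 3) b τ * (freqWeight lam s n * ‖U n τ‖ₑ) := by
  have := bracket_pos (n / lam)
  unfold weighted modWeight freqWeight
  rw [ENNReal.ofReal_mul (by positivity)]
  ring

/-- `‖ ⟨ξ⟩^s U(ξ, ·) ‖_{L¹}² + ‖ ⟨ξ⟩^s ⟨τ - α ξ³⟩^{1/2} U(ξ, ·) ‖_{L²}²`. -/
noncomputable def freqNormSq (lam α s : ℝ) (U : ℤ → ℝ → ℂ) (n : ℤ) : ℝ≥0∞ :=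
  fiberNormSq (α * (n / lam) ^ 3) (fun τ => freqWeight lam s n * ‖U n τ‖ₑ)

theorem freqNormSq_tsum_le (lam α s : ℝ) (U : ℤ → ℝ → ℂ) :
    ENNReal.ofReal (1 / (2 * Real.pi * lam)) * ∑' n, freqNormSq lam α s U n ≤
      (normL2L2 lam α s (1 / 2) U + normL2L1 lam α s 0 U) ^ 2 := by
  have h2 : normL2L2 lam α s (1 / 2) U ^ 2 = ENNReal.ofReal (1 / (2 * Real.pi * lam)) *
      ∑' n : ℤ, ∫⁻ τ : ℝ, (modWeight (α * (n / lam) ^ 3) (1 / 2) τ *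
        (freqWeight lam s n * ‖U n τ‖ₑ)) ^ 2 := by
    unfold normL2L2
    rw [ENNReal.rpow_half_sq]
    simp_rw [weighted_eq]
  have h1 : normL2L1 lam α s 0 U ^ 2 = ENNReal.ofReal (1 / (2 * Real.pi * lam)) *
      ∑' n : ℤ, (∫⁻ τ : ℝ, freqWeight lam s n * ‖U n τ‖ₑ) ^ 2 := by
    unfold normL2L1
    rw [ENNReal.rpow_half_sq]
    simp_rw [weighted_eq, modWeight_zero, one_mul]
  calc _ = normL2L1 lam α s 0 U ^ 2 + normL2L2 lam α s (1 / 2) U ^ 2 := by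
        rw [h1, h2, ← mul_add, ← ENNReal.tsum_add]
        rfl
    _ ≤ normL2L1 lam α s 0 U ^ 2 + normL2L2 lam α s (1 / 2) U ^ 2 +
        2 * (normL2L2 lam α s (1 / 2) U * normL2L1 lam α s 0 U) := le_self_add
    _ = _ := by ring

theorem ENNReal.tsum_tsum_mul_sub (A B : ℤ → ℝ≥0∞) :
    ∑' n : ℤ, ∑' m : ℤ, A m * B (n - m) = (∑' m, A m) * ∑' k, B k := by
  rw [ENNReal.tsum_comm]
  have : ∀ m : ℤ, ∑' n : ℤ, A m * B (n - m) = A m * ∑' k, B k := by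
    intro m
    rw [ENNReal.tsum_mul_left]
    congr 1
    exact (Equiv.subRight m).tsum_eq B
  simp_rw [this]
  rw [ENNReal.tsum_mul_right]

/-- `|ξ| ⟨ξ⟩^s ⟨ξ₁⟩^{-s} ⟨ξ - ξ₁⟩^{-s}`. -/
noncomputable def symbolWeight (s x y : ℝ) : ℝ :=
  |x| * (bracket x ^ s * (bracket y ^ (-s) * bracket (x - y) ^ (-s)))

theorem symbolWeight_nonneg (s x y : ℝ) : 0 ≤ symbolWeight s x y := by
  have := bracket_pos x
  have := bracket_pos y
  have := bracket_pos (x - y)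
  unfold symbolWeight; positivity

theorem symbolWeight_mul_sq (α s x y : ℝ) :
    (symbolWeight s x y * (1 + |resonance α x y|) ^ (-(1 / 2) : ℝ)) ^ 2 =
      multiplierSq α s x y := by
  have h1 := bracket_pos x
  have h2 := bracket_pos y
  have h3 := bracket_pos (x - y)
  have h4 : 0 < 1 + |resonance α x y| := by positivity
  have aux : ∀ {b : ℝ} (r : ℝ), 0 < b → (b ^ r) ^ 2 = b ^ (2 * r) := by
    intro b r hb
    rw [← Real.rpow_natCast, ← Real.rpow_mul hb.le]; congr 1; push_cast; ring
  unfold symbolWeight multiplierSq weightRatioSq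
  simp only [mul_pow, aux _ h1, aux _ h2, aux _ h3, aux _ h4, sq_abs]
  rw [show (2 * -(1 / 2) : ℝ) = -1 by norm_num, Real.rpow_neg_one]
  simp only [mul_neg]
  ring

theorem freqWeight_mul_lconv {lam : ℝ} (s : ℝ) (n m : ℤ) (F G : ℝ → ℝ≥0∞) (τ : ℝ) :
    ENNReal.ofReal |(n / lam : ℝ)| * (freqWeight lam s n * lconv F G τ) =
      ENNReal.ofReal (symbolWeight s (n / lam) (m / lam)) *
        lconv (fun x => freqWeight lam s m * F x) (fun x => freqWeight lam s (n - m) * G x) τ := by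
  have h1 := bracket_pos (n / lam : ℝ)
  have h2 := bracket_pos (m / lam : ℝ)
  have h3 := bracket_pos ((n / lam : ℝ) - m / lam)
  have hsub : (((n - m : ℤ) : ℝ) / lam) = n / lam - m / lam := by push_cast; ring
  rw [lconv_const_mul (by simp [freqWeight]), lconv_comm F (fun x => _ * G x),
    lconv_const_mul (by simp [freqWeight]), lconv_comm G F]
  have e : ENNReal.ofReal (symbolWeight s (n / lam) (m / lam)) *
      (freqWeight lam s m * freqWeight lam s (n - m)) =
      ENNReal.ofReal |(n / lam : ℝ)| * freqWeight lam s n := by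
    unfold freqWeight symbolWeight
    rw [hsub, ← ENNReal.ofReal_mul (by positivity), ← ENNReal.ofReal_mul (by positivity),
      ← ENNReal.ofReal_mul (by positivity)]
    congr 1
    have p2 := (Real.rpow_pos_of_pos h2 s).ne'
    have p3 := (Real.rpow_pos_of_pos h3 s).ne'
    rw [Real.rpow_neg h2.le, Real.rpow_neg h3.le]
    generalize bracket (m / lam : ℝ) ^ s = Y at p2 ⊢
    generalize bracket ((n / lam : ℝ) - m / lam) ^ s = Z at p3 ⊢
    field_simp
  calc _ = (ENNReal.ofReal |(n / lam : ℝ)| * freqWeight lam s n) * lconv F G τ := by ring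
    _ = _ := by rw [← e]; ring

/-- `W` is dominated by `|ξ|` times the convolution of `U` and `V` without the frequency
`ξ₁ = 0`. -/
def DominatedByConv (lam : ℝ) (U V W : ℤ → ℝ → ℂ) : Prop :=
  ∀ (n : ℤ) (τ : ℝ), ‖W n τ‖ₑ ≤ ENNReal.ofReal (1 / (2 * Real.pi * lam)) *
    (ENNReal.ofReal |(n / lam : ℝ)| *
      ∑' m : ℤ, if m = 0 then 0 else lconv (fun x => ‖U m x‖ₑ) (fun x => ‖V (n - m) x‖ₑ) τ)

/-- The multiplier, set to zero at `ξ₁ = 0`. -/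
noncomputable def truncMultiplier (lam α s : ℝ) (n m : ℤ) : ℝ≥0∞ :=
  if m = 0 then 0 else ENNReal.ofReal (symbolWeight s (n / lam) (m / lam) *
    (1 + |resonance α (n / lam) (m / lam)|) ^ (-(1 / 2) : ℝ))

theorem tsum_multiplier_mul_sq_le {lam α s : ℝ} (hl : 1 ≤ lam) {D : ℝ≥0∞} {n : ℤ}
    (hD : ∑' m : ℤ, (if m = 0 then 0 else
        ENNReal.ofReal (multiplierSq α s (n / lam) (m / lam) / lam)) ≤ D) (h : ℤ → ℝ≥0∞) :
    (∑' m : ℤ, ENNReal.ofReal (1 / (2 * Real.pi * lam)) * (truncMultiplier lam α s n m * h m)) ^ 2 ≤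
      D * (ENNReal.ofReal (1 / (2 * Real.pi * lam)) * ∑' m : ℤ, h m ^ 2) := by
  have h0 : 0 < lam := by linarith
  set κ := ENNReal.ofReal (1 / (2 * Real.pi * lam))
  have hκ : κ ≤ ENNReal.ofReal (1 / lam) := by
    apply ENNReal.ofReal_le_ofReal
    have := Real.pi_gt_three
    gcongr
    nlinarith
  calc (∑' m : ℤ, κ * (truncMultiplier lam α s n m * h m)) ^ 2
      = κ ^ 2 * (∑' m : ℤ, truncMultiplier lam α s n m * h m) ^ 2 := by
        rw [ENNReal.tsum_mul_left, mul_pow]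
    _ ≤ κ ^ 2 * ((∑' m : ℤ, truncMultiplier lam α s n m ^ 2) * ∑' m : ℤ, h m ^ 2) := by
        gcongr
        exact ENNReal.tsum_mul_sq_le _ _
    _ = (κ * ∑' m : ℤ, truncMultiplier lam α s n m ^ 2) * (κ * ∑' m : ℤ, h m ^ 2) := by ring
    _ ≤ _ := by
        gcongr
        rw [← ENNReal.tsum_mul_left]
        refine le_trans (ENNReal.tsum_le_tsum fun m => ?_) hD
        unfold truncMultiplier
        split_ifs with hm
        · simp
        · rw [← ENNReal.ofReal_pow (mul_nonneg (symbolWeight_nonneg _ _ _) (by positivity)),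
            symbolWeight_mul_sq]
          calc _ ≤ ENNReal.ofReal (1 / lam) *
                ENNReal.ofReal (multiplierSq α s (n / lam) (m / lam)) := by gcongr
            _ = _ := by
              rw [← ENNReal.ofReal_mul (by positivity)]; congr 1; ring

section
variable {lam α s : ℝ} {U V W : ℤ → ℝ → ℂ}

/-- The profile `⟨ξ⟩^s |U(ξ, ·)|`. -/
noncomputable def profile (lam s : ℝ) (U : ℤ → ℝ → ℂ) (n : ℤ) (τ : ℝ) : ℝ≥0∞ :=
  freqWeight lam s n * ‖U n τ‖ₑ

theorem measurable_profile (hU : ∀ n, Measurable (U n)) (n : ℤ) :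
    Measurable (profile lam s U n) := by
  have := hU n
  unfold profile
  fun_prop

theorem weighted_le_tsum (hW : DominatedByConv lam U V W) (b : ℝ) (n : ℤ) (τ : ℝ) :
    weighted lam α s b W n τ ≤ ∑' m : ℤ, ENNReal.ofReal (1 / (2 * Real.pi * lam)) *
      (if m = 0 then 0 else ENNReal.ofReal (symbolWeight s (n / lam) (m / lam)) *
        (modWeight (α * (n / lam) ^ 3) b τ *
          lconv (profile lam s U m) (profile lam s V (n - m)) τ)) := by
  rw [weighted_eq]
  set κ := ENNReal.ofReal (1 / (2 * Real.pi * lam))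
  set w := modWeight (α * (n / lam) ^ 3) b τ
  calc w * (freqWeight lam s n * ‖W n τ‖ₑ) ≤ w * (freqWeight lam s n * (κ *
        (ENNReal.ofReal |(n / lam : ℝ)| * ∑' m : ℤ, if m = 0 then 0 else
          lconv (fun x => ‖U m x‖ₑ) (fun x => ‖V (n - m) x‖ₑ) τ))) := by
        gcongr
        exact hW n τ
    _ = (w * freqWeight lam s n * κ * ENNReal.ofReal |(n / lam : ℝ)|) *
        ∑' m : ℤ, (if m = 0 then 0 else
          lconv (fun x => ‖U m x‖ₑ) (fun x => ‖V (n - m) x‖ₑ) τ) := by ring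
    _ = _ := by
        rw [← ENNReal.tsum_mul_left]
        refine tsum_congr fun m => ?_
        split_ifs with hm
        · simp
        · have := freqWeight_mul_lconv (lam := lam) s n m (fun x => ‖U m x‖ₑ)
            (fun x => ‖V (n - m) x‖ₑ) τ
          unfold profile
          calc _ = κ * (w * (ENNReal.ofReal |(n / lam : ℝ)| * (freqWeight lam s n *
                lconv (fun x => ‖U m x‖ₑ) (fun x => ‖V (n - m) x‖ₑ) τ))) := by ring
            _ = _ := by rw [this]; ring

theorem resonance_freq (lam α : ℝ) (n m : ℤ) :
    1 * (m / lam : ℝ) ^ 3 + α * (((n - m : ℤ) : ℝ) / lam) ^ 3 - α * (n / lam) ^ 3 =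
      resonance α (n / lam) (m / lam) := by
  unfold resonance; push_cast; ring

theorem normL2L2_sq_le (hl : 1 ≤ lam) (hU : ∀ n, Measurable (U n)) (hV : ∀ n, Measurable (V n))
    (hW : DominatedByConv lam U V W) {D : ℝ≥0∞}
    (hD : ∀ n : ℤ, ∑' m : ℤ, (if m = 0 then 0 else
        ENNReal.ofReal (multiplierSq α s (n / lam) (m / lam) / lam)) ≤ D) :
    normL2L2 lam α s (-1 / 2) W ^ 2 ≤ 9 * D *
      ((normL2L2 lam 1 s (1 / 2) U + normL2L1 lam 1 s 0 U) ^ 2 *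
        (normL2L2 lam α s (1 / 2) V + normL2L1 lam α s 0 V) ^ 2) := by
  have hA := freqNormSq_tsum_le lam 1 s U
  have hB := freqNormSq_tsum_le lam α s V
  rw [normL2L2, ENNReal.rpow_half_sq]
  set κ := ENNReal.ofReal (1 / (2 * Real.pi * lam)) with hκ
  set h : ℤ → ℤ → ℝ → ℝ≥0∞ := fun n m => modSum (1 * (m / lam : ℝ) ^ 3)
    (α * (((n - m : ℤ) : ℝ) / lam) ^ 3) (profile lam s U m) (profile lam s V (n - m)) with hh
  have hmeas : ∀ n m, Measurable (h n m) := fun n m =>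
    measurable_modSum (measurable_profile hU m) (measurable_profile hV (n - m)) _ _
  have pt : ∀ n τ, weighted lam α s (-1 / 2) W n τ ≤
      ∑' m : ℤ, κ * (truncMultiplier lam α s n m * h n m τ) := by
    intro n τ
    refine (weighted_le_tsum hW _ n τ).trans (ENNReal.tsum_le_tsum fun m => ?_)
    rw [← hκ]
    gcongr
    unfold truncMultiplier
    split_ifs with hm
    · simp
    · have := modWeight_mul_lconv_le (measurable_profile (lam := lam) (s := s) hU m)
        (measurable_profile (lam := lam) (s := s) hV (n - m)) (α * (n / lam) ^ 3)
        (1 * (m / lam : ℝ) ^ 3) (α * (((n - m : ℤ) : ℝ) / lam) ^ 3) τ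
      rw [resonance_freq] at this
      rw [ENNReal.ofReal_mul (symbolWeight_nonneg _ _ _),
        mul_assoc (ENNReal.ofReal (symbolWeight _ _ _))]
      gcongr
  calc κ * ∑' n : ℤ, ∫⁻ τ, weighted lam α s (-1 / 2) W n τ ^ 2
      ≤ κ * ∑' n : ℤ, ∫⁻ τ, D * (κ * ∑' m : ℤ, h n m τ ^ 2) := by
        gcongr with n τ
        refine le_trans ?_ (tsum_multiplier_mul_sq_le hl (hD n) fun m => h n m τ)
        gcongr
        exact pt n τ
    _ = κ * ∑' n : ℤ, D * (κ * ∑' m : ℤ, ∫⁻ τ, h n m τ ^ 2) := by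
        congr 1
        refine tsum_congr fun n => ?_
        have hm2 : ∀ m, Measurable fun τ => h n m τ ^ 2 := fun m => (hmeas n m).pow_const 2
        rw [lintegral_const_mul _ ((Measurable.tsum hm2).const_mul _),
          lintegral_const_mul _ (Measurable.tsum hm2),
          lintegral_tsum fun m => (hm2 m).aemeasurable]
    _ ≤ κ * ∑' n : ℤ, D * (κ * ∑' m : ℤ,
          9 * (freqNormSq lam 1 s U m * freqNormSq lam α s V (n - m))) := by
        gcongr with n m
        exact lintegral_modSum_sq_le (measurable_profile hU m) (measurable_profile hV (n - m)) _ _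
    _ = 9 * D * ((κ * ∑' n, freqNormSq lam 1 s U n) * (κ * ∑' n, freqNormSq lam α s V n)) := by
        simp_rw [ENNReal.tsum_mul_left]
        rw [ENNReal.tsum_tsum_mul_sub]
        ring
    _ ≤ _ := by gcongr

theorem normL2L1_sq_le (hl : 1 ≤ lam) (hU : ∀ n, Measurable (U n)) (hV : ∀ n, Measurable (V n))
    (hW : DominatedByConv lam U V W) {D : ℝ≥0∞}
    (hD : ∀ n : ℤ, ∑' m : ℤ, (if m = 0 then 0 else
        ENNReal.ofReal (multiplierSq α s (n / lam) (m / lam) / lam)) ≤ D) :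
    normL2L1 lam α s (-1) W ^ 2 ≤ 9 * (1 + modConst) * D *
      ((normL2L2 lam 1 s (1 / 2) U + normL2L1 lam 1 s 0 U) ^ 2 *
        (normL2L2 lam α s (1 / 2) V + normL2L1 lam α s 0 V) ^ 2) := by
  have hA := freqNormSq_tsum_le lam 1 s U
  have hB := freqNormSq_tsum_le lam α s V
  rw [normL2L1, ENNReal.rpow_half_sq]
  set κ := ENNReal.ofReal (1 / (2 * Real.pi * lam)) with hκ
  set E : ℤ → ℤ → ℝ≥0∞ := fun n m => (9 * (1 + modConst) *
    (freqNormSq lam 1 s U m * freqNormSq lam α s V (n - m))) ^ (1 / 2 : ℝ) with hE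
  have pt : ∀ n, ∫⁻ τ, weighted lam α s (-1) W n τ ≤
      ∑' m : ℤ, κ * (truncMultiplier lam α s n m * E n m) := by
    intro n
    have mc := measurable_modWeight (α * (n / lam) ^ 3) (-1)
    have ml : ∀ m : ℤ, Measurable (lconv (profile lam s U m) (profile lam s V (n - m))) :=
      fun m => measurable_lconv (measurable_profile hU m) (measurable_profile hV (n - m))
    refine (lintegral_mono (weighted_le_tsum hW _ n)).trans ?_
    rw [lintegral_tsum]
    swap
    · intro m
      have := ml m
      split_ifs <;> fun_prop
    refine ENNReal.tsum_le_tsum fun m => ?_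
    unfold truncMultiplier
    split_ifs with hm
    · simp
    · have hml := ml m
      have := lintegral_modWeight_mul_lconv_sq_le
        (measurable_profile (lam := lam) (s := s) hU m)
        (measurable_profile (lam := lam) (s := s) hV (n - m)) (α * (n / lam) ^ 3)
        (1 * (m / lam : ℝ) ^ 3) (α * (((n - m : ℤ) : ℝ) / lam) ^ 3)
      rw [resonance_freq] at this
      rw [lintegral_const_mul _ (by fun_prop), lintegral_const_mul _ (by fun_prop),
        ENNReal.ofReal_mul (symbolWeight_nonneg _ _ _),
        mul_assoc (ENNReal.ofReal (symbolWeight _ _ _))]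
      gcongr
      have h2 := ENNReal.rpow_le_rpow this (by norm_num : (0 : ℝ) ≤ 1 / 2)
      rw [ENNReal.sq_rpow_half, ENNReal.mul_rpow_of_nonneg _ _ (by norm_num),
        ENNReal.sq_rpow_half] at h2
      exact h2
  calc κ * ∑' n : ℤ, (∫⁻ τ, weighted lam α s (-1) W n τ) ^ 2
      ≤ κ * ∑' n : ℤ, D * (κ * ∑' m : ℤ, E n m ^ 2) := by
        gcongr with n
        refine le_trans ?_ (tsum_multiplier_mul_sq_le hl (hD n) (E n))
        gcongr
        exact pt n
    _ = 9 * (1 + modConst) * D *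
          ((κ * ∑' n, freqNormSq lam 1 s U n) * (κ * ∑' n, freqNormSq lam α s V n)) := by
        simp_rw [hE, ENNReal.rpow_half_sq, ENNReal.tsum_mul_left]
        rw [ENNReal.tsum_tsum_mul_sub]
        ring
    _ ≤ _ := by gcongr

theorem fourier_side_estimate (hl : 1 ≤ lam) (hU : ∀ n, Measurable (U n))
    (hV : ∀ n, Measurable (V n)) (hW : DominatedByConv lam U V W) {D : ℝ≥0∞}
    (hD : ∀ n : ℤ, ∑' m : ℤ, (if m = 0 then 0 else
        ENNReal.ofReal (multiplierSq α s (n / lam) (m / lam) / lam)) ≤ D) :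
    normL2L2 lam α s (-1 / 2) W + normL2L1 lam α s (-1) W ≤
      2 * (9 * (1 + modConst) * D) ^ (1 / 2 : ℝ) *
        (normL2L2 lam 1 s (1 / 2) U + normL2L1 lam 1 s 0 U) *
        (normL2L2 lam α s (1 / 2) V + normL2L1 lam α s 0 V) := by
  have h1 := normL2L2_sq_le hl hU hV hW hD
  have h2 := normL2L1_sq_le hl hU hV hW hD
  set a := normL2L2 lam 1 s (1 / 2) U + normL2L1 lam 1 s 0 U
  set b := normL2L2 lam α s (1 / 2) V + normL2L1 lam α s 0 V
  have root : ∀ x : ℝ≥0∞, x ^ 2 ≤ 9 * (1 + modConst) * D * (a ^ 2 * b ^ 2) →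
      x ≤ (9 * (1 + modConst) * D) ^ (1 / 2 : ℝ) * (a * b) := by
    intro x hx
    have h := ENNReal.rpow_le_rpow hx (by norm_num : (0 : ℝ) ≤ 1 / 2)
    rwa [ENNReal.sq_rpow_half, ENNReal.mul_rpow_of_nonneg _ _ (by norm_num), ← mul_pow,
      ENNReal.sq_rpow_half] at h
  have h1' : normL2L2 lam α s (-1 / 2) W ^ 2 ≤ 9 * (1 + modConst) * D * (a ^ 2 * b ^ 2) := by
    refine h1.trans ?_
    gcongr
    exact le_mul_of_one_le_right' le_self_add
  calc _ ≤ (9 * (1 + modConst) * D) ^ (1 / 2 : ℝ) * (a * b) +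
        (9 * (1 + modConst) * D) ^ (1 / 2 : ℝ) * (a * b) := add_le_add (root _ h1') (root _ h2)
    _ = _ := by ring

end

/-! ### Parseval's identity on the torus -/

theorem hasSum_fourierIntegral_mul {T : ℝ} [hT : Fact (0 < T)] {f g : AddCircle T → ℂ}
    (hf : MemLp f 2) (hg : MemLp g 2) (n : ℤ) :
    HasSum (fun m : ℤ => (T : ℂ)⁻¹ * ((∫ x, fourier (-m) x * f x) *
      ∫ x, fourier (-(n - m)) x * g x)) (∫ x, fourier (-n) x * (f x * g x)) := by
  have hT0 : 0 < T := hT.out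
  have hle : (AddCircle.haarAddCircle : Measure (AddCircle T)) ≤
      (ENNReal.ofReal T)⁻¹ • (volume : Measure (AddCircle T)) := by
    rw [AddCircle.volume_eq_smul_haarAddCircle, smul_smul, ENNReal.inv_mul_cancel
      (by simpa using hT0) ENNReal.ofReal_ne_top, one_smul]
  have hc : (ENNReal.ofReal T)⁻¹ ≠ ⊤ := by simpa using hT0
  have hf' : MemLp f 2 AddCircle.haarAddCircle := hf.of_measure_le_smul hc hle
  have hg' : MemLp g 2 AddCircle.haarAddCircle := hg.of_measure_le_smul hc hle
  have hG : MemLp (fun x => (starRingEnd ℂ) (fourier (-n) x * g x)) 2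
      (AddCircle.haarAddCircle : Measure (AddCircle T)) := by
    refine hg'.of_le ?_ (Filter.Eventually.of_forall fun x => ?_)
    · exact Complex.continuous_conj.comp_aestronglyMeasurable
        ((ContinuousMap.continuous _).aestronglyMeasurable.mul hg'.1)
    · rw [RCLike.norm_conj, norm_mul, fourier_apply, Circle.norm_coe, one_mul]
  have H := (fourierBasis (T := T)).hasSum_inner_mul_inner (hG.toLp _) (hf'.toLp _)
  have e1 : ∀ m : ℤ, inner ℂ (fourierBasis (T := T) m) (hf'.toLp _) =
      (T : ℂ)⁻¹ * ∫ x, fourier (-m) x * f x := by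
    intro m
    rw [← HilbertBasis.repr_apply_apply, fourierBasis_repr, fourierCoeff,
      AddCircle.integral_haarAddCircle, Complex.real_smul, Complex.ofReal_inv]
    congr 1
    have := AddCircle.volume_eq_smul_haarAddCircle (T := T)
    apply integral_congr_ae
    have hae := hf'.coeFn_toLp
    have : ∀ᵐ x : AddCircle T, (hf'.toLp f) x = f x := by
      rw [this]
      exact Measure.ae_smul_measure hae _
    filter_upwards [this] with x hx
    rw [hx, smul_eq_mul]
  have e2 : ∀ m : ℤ, inner ℂ (hG.toLp _) (fourierBasis (T := T) m) =
      (T : ℂ)⁻¹ * ∫ x, fourier (-(n - m)) x * g x := by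
    intro m
    rw [L2.inner_def]
    have : ∫ a, inner ℂ ((hG.toLp _) a) ((fourierBasis (T := T) m : Lp ℂ 2 _) a)
        ∂AddCircle.haarAddCircle = ∫ x : AddCircle T, fourier (-(n - m)) x * g x
        ∂AddCircle.haarAddCircle := by
      apply integral_congr_ae
      rw [coe_fourierBasis]
      filter_upwards [hG.coeFn_toLp, coeFn_fourierLp 2 m] with x hx hx'
      rw [hx, hx', RCLike.inner_apply', Complex.conj_conj,
        show (-(n - m)) = -n + m by ring, fourier_add]
      ring
    rw [this, AddCircle.integral_haarAddCircle, Complex.real_smul, Complex.ofReal_inv]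
  have e3 : inner ℂ (hG.toLp _) (hf'.toLp _) =
      (T : ℂ)⁻¹ * ∫ x, fourier (-n) x * (f x * g x) := by
    rw [L2.inner_def]
    have : ∫ a, inner ℂ ((hG.toLp _) a) ((hf'.toLp f) a)
        ∂AddCircle.haarAddCircle = ∫ x : AddCircle T, fourier (-n) x * (f x * g x)
        ∂AddCircle.haarAddCircle := by
      apply integral_congr_ae
      filter_upwards [hG.coeFn_toLp, hf'.coeFn_toLp] with x hx hx'
      rw [hx, hx', RCLike.inner_apply', Complex.conj_conj]
      ring
    rw [this, AddCircle.integral_haarAddCircle, Complex.real_smul, Complex.ofReal_inv]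
  simp_rw [e1, e2] at H
  rw [e3] at H
  have hTc : (T : ℂ) ≠ 0 := by exact_mod_cast hT0.ne'
  have H' := H.mul_left (T : ℂ)
  rw [mul_inv_cancel_left₀ hTc] at H'
  refine H'.congr_fun fun m => ?_
  field_simp

/-! ### Fourier inversion on the line -/

theorem integral_fourierInv_mul_eq {G H : ℝ → ℂ} (hG : Integrable G) (hH : Integrable H) :
    ∫ w, 𝓕⁻ G w * H w = ∫ x, G x * 𝓕⁻ H x := by
  have hH' : Integrable (fun x => H (-x)) := hH.comp_neg
  calc ∫ w, 𝓕⁻ G w * H w = ∫ w, 𝓕 G (-w) * H w := by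
        simp_rw [Real.fourierInv_eq_fourier_neg]
    _ = ∫ w, 𝓕 G w * H (-w) := by
        rw [← integral_neg_eq_self]; simp
    _ = ∫ x, G x * 𝓕 (fun x => H (-x)) x := by
        have := VectorFourier.integral_fourierIntegral_smul_eq_flip (𝕜 := ℝ) (L := innerₗ ℝ)
          (μ := volume) (ν := volume) (e := Real.fourierChar) Real.continuous_fourierChar
          (by exact continuous_inner) hG hH'
        rw [flip_innerₗ] at this
        exact this
    _ = _ := by rw [Real.fourierInv_eq_fourier_comp_neg]

theorem fourierTest_integral_eq (φ : 𝓢(ℝ, ℂ)) (t : ℝ) :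
    ∫ τ : ℝ, Complex.exp (-(I * t * τ)) * φ τ = 𝓕 φ (t / (2 * Real.pi)) := by
  rw [SchwartzMap.fourier_coe, Real.fourier_real_eq_integral_exp_smul]
  refine integral_congr_ae (Filter.Eventually.of_forall fun τ => ?_)
  simp only [smul_eq_mul]
  congr 2
  push_cast
  have : (Real.pi : ℂ) ≠ 0 := by exact_mod_cast Real.pi_ne_zero
  field_simp

theorem integral_fourierInv_mul_fourier {G : ℝ → ℂ} (hG : Integrable G) (φ : 𝓢(ℝ, ℂ)) :
    ∫ t : ℝ, 𝓕⁻ G (t / (2 * Real.pi)) * 𝓕 φ (t / (2 * Real.pi)) =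
      (2 * Real.pi : ℝ) * ∫ τ, G τ * φ τ := by
  have h := Measure.integral_comp_div (fun w => 𝓕⁻ G w * 𝓕 φ w) (2 * Real.pi)
  rw [h, integral_fourierInv_mul_eq hG (𝓕 φ).integrable, abs_of_pos Real.two_pi_pos,
    Complex.real_smul, ← SchwartzMap.fourierInv_coe, FourierTransform.fourierInv_fourier_eq]

theorem continuous_fourierInv {G : ℝ → ℂ} (hG : Integrable G) : Continuous (𝓕⁻ G) := by
  have h : Continuous (𝓕 G) := VectorFourier.fourierIntegral_continuous
    Real.continuous_fourierChar (by exact continuous_inner) hG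
  have : (𝓕⁻ G) = fun w => 𝓕 G (-w) := by
    ext w; exact Real.fourierInv_eq_fourier_neg G w
  rw [this]
  exact h.comp continuous_neg

theorem enorm_fourierInv_le (G : ℝ → ℂ) (w : ℝ) : ‖𝓕⁻ G w‖ₑ ≤ ∫⁻ x, ‖G x‖ₑ := by
  rw [Real.fourierInv_eq]
  refine (enorm_integral_le_lintegral_enorm _).trans (le_of_eq ?_)
  refine lintegral_congr fun x => ?_
  rw [← ofReal_norm, ← ofReal_norm, Circle.norm_smul]

/-- A locally integrable function whose distributional Fourier transform is the integrable
function `G` is the inverse Fourier transform of `G`. -/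
theorem ae_eq_fourierInv {g G : ℝ → ℂ} (hg : LocallyIntegrable g) (hG : Integrable G)
    (h : ∀ φ : 𝓢(ℝ, ℂ), ∫ t, g t * 𝓕 φ (t / (2 * Real.pi)) = ∫ τ, G τ * φ τ) :
    ∀ᵐ t, g t = (2 * Real.pi : ℝ)⁻¹ * 𝓕⁻ G (t / (2 * Real.pi)) := by
  have hpi := Real.two_pi_pos
  have hcont : Continuous fun t : ℝ =>
      (((2 * Real.pi)⁻¹ : ℝ) : ℂ) * 𝓕⁻ G (t / (2 * Real.pi)) :=
    continuous_const.mul ((continuous_fourierInv hG).comp (continuous_id.div_const _))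
  refine ae_eq_of_integral_contDiff_smul_eq hg hcont.locallyIntegrable fun ψ hψ hψc => ?_
  have hs : HasCompactSupport fun w : ℝ => (ψ (2 * Real.pi * w) : ℂ) := by
    have h1 : HasCompactSupport fun w : ℝ => ψ (2 * Real.pi * w) :=
      hψc.comp_homeomorph (Homeomorph.mulLeft₀ (2 * Real.pi) hpi.ne')
    exact h1.comp_left (g := fun r : ℝ => (r : ℂ)) (by simp)
  have hd : ContDiff ℝ (⊤ : ℕ∞) fun w : ℝ => (ψ (2 * Real.pi * w) : ℂ) :=
    Complex.ofRealCLM.contDiff.comp (hψ.comp (contDiff_const.mul contDiff_id))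
  set Ψ : 𝓢(ℝ, ℂ) := hs.toSchwartzMap hd
  have hΨ : ∀ t : ℝ, 𝓕 (𝓕⁻ Ψ) (t / (2 * Real.pi)) = (ψ t : ℂ) := by
    intro t
    rw [FourierTransform.fourier_fourierInv_eq]
    change ((ψ (2 * Real.pi * (t / (2 * Real.pi))) : ℝ) : ℂ) = _
    rw [mul_div_cancel₀ _ hpi.ne']
  have h1 := h (𝓕⁻ Ψ)
  have h2 := integral_fourierInv_mul_fourier hG (𝓕⁻ Ψ)
  simp_rw [hΨ] at h1 h2
  have hc : ((2 * Real.pi : ℝ) : ℂ) ≠ 0 := by exact_mod_cast hpi.ne'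
  calc ∫ t, ψ t • g t = ∫ t, g t * ψ t := by
        simp_rw [Complex.real_smul, mul_comm]
    _ = ((2 * Real.pi : ℝ) : ℂ)⁻¹ * ((2 * Real.pi : ℝ) * ∫ τ, G τ * (𝓕⁻ Ψ) τ) := by
        rw [h1, inv_mul_cancel_left₀ hc]
    _ = ∫ t, ((2 * Real.pi : ℝ) : ℂ)⁻¹ * (𝓕⁻ G (t / (2 * Real.pi)) * ψ t) := by
        rw [← h2, integral_const_mul]
    _ = _ := by
        refine integral_congr_ae (Filter.Eventually.of_forall fun t => ?_)
        simp only [Complex.real_smul]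
        push_cast
        ring

/-! ### Fourier coefficients in `x` -/

/-- The Schwartz function `t ↦ ∫ exp (-i t τ) φ(τ) dτ`. -/
noncomputable def angularFourier (φ : 𝓢(ℝ, ℂ)) : 𝓢(ℝ, ℂ) :=
  SchwartzMap.compCLMOfContinuousLinearEquiv ℂ
    (ContinuousLinearEquiv.unitsEquivAut ℝ (Units.mk0 (2 * Real.pi)⁻¹ (by positivity))) (𝓕 φ)

theorem angularFourier_apply (φ : 𝓢(ℝ, ℂ)) (t : ℝ) :
    angularFourier φ t = 𝓕 φ (t / (2 * Real.pi)) := by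
  simp [angularFourier, div_eq_mul_inv]

section
variable {lam : ℝ}

theorem fourierTest_eq (n : ℤ) (φ : 𝓢(ℝ, ℂ)) :
    fourierTest lam n φ = fun p => fourier (-n) p.1 * angularFourier φ p.2 := by
  ext p
  rw [fourierTest, fourierTest_integral_eq, angularFourier_apply]

theorem deriv_fourierTest (hl : 0 < lam) (n : ℤ) (φ : 𝓢(ℝ, ℂ)) (p : Torus lam × ℝ) :
    deriv (fun y : ℝ => fourierTest lam n φ (p.1 + (y : Torus lam), p.2)) 0 =
      -(I * (n / lam)) * fourierTest lam n φ p := by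
  have h := (hasDerivAt_fourier_neg (2 * Real.pi * lam) n 0).const_mul
    (fourier (-n) p.1 * angularFourier φ p.2)
  have e : (fun y : ℝ => fourierTest lam n φ (p.1 + (y : Torus lam), p.2)) =
      fun y : ℝ => fourier (-n) p.1 * angularFourier φ p.2 * fourier (-n) (y : Torus lam) := by
    ext y
    rw [fourierTest_eq]
    simp only [fourier_apply, smul_add, AddCircle.toCircle_add, Circle.coe_mul]
    ring
  rw [e, h.deriv, fourierTest_eq]
  have h1 : ((2 * Real.pi * lam : ℝ) : ℂ) ≠ 0 := by
    have := Real.pi_pos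
    exact_mod_cast (by positivity : 2 * Real.pi * lam ≠ 0)
  have h2 : (Real.pi : ℂ) ≠ 0 := by exact_mod_cast Real.pi_ne_zero
  have h3 : (lam : ℂ) ≠ 0 := by exact_mod_cast hl.ne'
  simp only [AddCircle.coe_zero, fourier_eval_zero, mul_one]
  push_cast
  field_simp

variable [Fact (0 < 2 * Real.pi * lam)]

/-- The unnormalized Fourier coefficient `∫ exp (-i (n / lam) x) w(x, t) dx`. -/
noncomputable def torusCoeff (w : Torus lam × ℝ → ℂ) (n : ℤ) (t : ℝ) : ℂ :=
  ∫ x : Torus lam, fourier (-n) x * w (x, t)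

theorem ofFunction_fourierTest {w : Torus lam × ℝ → ℂ} {n : ℤ} {φ : 𝓢(ℝ, ℂ)}
    (hw : Integrable fun p => w p * fourierTest lam n φ p) :
    ofFunction lam w (fourierTest lam n φ) =
      ∫ t, torusCoeff w n t * 𝓕 φ (t / (2 * Real.pi)) := by
  unfold ofFunction
  rw [Measure.volume_eq_prod] at hw ⊢
  rw [integral_prod_symm _ hw]
  refine integral_congr_ae (Filter.Eventually.of_forall fun t => ?_)
  simp only [torusCoeff, fourierTest_eq, ← angularFourier_apply]
  rw [← integral_mul_const]
  refine integral_congr_ae (Filter.Eventually.of_forall fun x => ?_)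
  simp only
  ring

theorem memLp_fourierTest (n : ℤ) (φ : 𝓢(ℝ, ℂ)) : MemLp (fourierTest lam n φ) 2 := by
  rw [fourierTest_eq, Measure.volume_eq_prod]
  have h : MemLp (fun p : Torus lam × ℝ => angularFourier φ p.2) 2
      ((volume : Measure (Torus lam)).prod volume) :=
    ((angularFourier φ).memLp 2 volume).comp_snd _
  refine h.of_le ?_ (Filter.Eventually.of_forall fun p => ?_)
  · exact ((ContinuousMap.continuous _).comp continuous_fst).aestronglyMeasurable.mul h.1
  · rw [norm_mul, fourier_apply, Circle.norm_coe, one_mul]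

theorem integrable_mul_fourierTest {w : Torus lam × ℝ → ℂ} (hw : MemLp w 2) (n : ℤ)
    (φ : 𝓢(ℝ, ℂ)) : Integrable fun p => w p * fourierTest lam n φ p :=
  hw.integrable_mul (memLp_fourierTest n φ)

theorem integrable_mul_mul_fourierTest {u v : Torus lam × ℝ → ℂ} (hu : MemLp u 2)
    (hv : MemLp v 2) (n : ℤ) (φ : 𝓢(ℝ, ℂ)) :
    Integrable fun p => u p * v p * fourierTest lam n φ p := by
  have huv : Integrable fun p => u p * v p := hu.integrable_mul hv
  obtain ⟨C, hC⟩ : ∃ C, ∀ p, ‖fourierTest lam n φ p‖ ≤ C := by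
    refine ⟨SchwartzMap.seminorm ℝ 0 0 (angularFourier φ), fun p => ?_⟩
    rw [fourierTest_eq]
    simp only [norm_mul, fourier_apply, Circle.norm_coe, one_mul]
    exact SchwartzMap.norm_le_seminorm ℝ _ _
  exact huv.mul_bdd (c := C) (memLp_fourierTest n φ).1 (Filter.Eventually.of_forall hC)

theorem locallyIntegrable_torusCoeff {w : Torus lam × ℝ → ℂ} (hw : MemLp w 2) (n : ℤ) :
    LocallyIntegrable (torusCoeff w n) := by
  rw [locallyIntegrable_iff]
  intro K hK
  have : IsFiniteMeasure ((volume : Measure ℝ).restrict K) :=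
    ⟨by simpa using hK.measure_lt_top⟩
  have h1 : MemLp w 2 ((volume : Measure (Torus lam)).prod (volume.restrict K)) := by
    have := hw.restrict (Set.univ ×ˢ K)
    rwa [Measure.volume_eq_prod, ← Measure.prod_restrict, Measure.restrict_univ] at this
  have h2 : Integrable w ((volume : Measure (Torus lam)).prod (volume.restrict K)) :=
    h1.integrable (by norm_num)
  have h3 : Integrable (fun p : Torus lam × ℝ => fourier (-n) p.1 * w p)
      ((volume : Measure (Torus lam)).prod (volume.restrict K)) := by
    refine h2.bdd_mul (c := 1) ?_ (Filter.Eventually.of_forall fun p => ?_)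
    · exact ((ContinuousMap.continuous _).comp continuous_fst).aestronglyMeasurable
    · rw [fourier_apply, Circle.norm_coe]
  exact h3.integral_prod_right

theorem ae_torusCoeff_eq {w : Torus lam × ℝ → ℂ} {U : ℤ → ℝ → ℂ} (hw : MemLp w 2)
    (hU : IsSpaceTimeFourier (ofFunction lam w) U) {n : ℤ} (hUn : Integrable (U n)) :
    ∀ᵐ t, torusCoeff w n t = (2 * Real.pi : ℝ)⁻¹ * 𝓕⁻ (U n) (t / (2 * Real.pi)) := by
  refine ae_eq_fourierInv (locallyIntegrable_torusCoeff hw n) hUn fun φ => ?_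
  rw [← (hU n φ).2, ofFunction_fourierTest (integrable_mul_fourierTest hw n φ)]

theorem ae_memLp_slice {w : Torus lam × ℝ → ℂ} (hw : MemLp w 2) :
    ∀ᵐ t : ℝ, MemLp (fun x : Torus lam => w (x, t)) 2 := by
  rw [Measure.volume_eq_prod] at hw
  have h1 : ∀ᵐ t : ℝ, AEStronglyMeasurable (fun x : Torus lam => w (x, t)) :=
    hw.1.prod_swap.prodMk_left
  have h2 := ((memLp_two_iff_integrable_sq_norm hw.1).mp hw).prod_left_ae
  filter_upwards [h1, h2] with t ht1 ht2
  exact (memLp_two_iff_integrable_sq_norm ht1).mpr ht2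

theorem ae_hasSum_torusCoeff {u v : Torus lam × ℝ → ℂ} (hu : MemLp u 2) (hv : MemLp v 2)
    (n : ℤ) : ∀ᵐ t : ℝ, HasSum (fun m : ℤ => ((2 * Real.pi * lam : ℝ) : ℂ)⁻¹ *
      (torusCoeff u m t * torusCoeff v (n - m) t)) (torusCoeff (fun p => u p * v p) n t) := by
  filter_upwards [ae_memLp_slice hu, ae_memLp_slice hv] with t h1 h2
  exact hasSum_fourierIntegral_mul h1 h2 n

theorem ae_torusCoeff_zero {u : Torus lam × ℝ → ℂ} (hu : MeanZero lam u) :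
    ∀ᵐ t : ℝ, torusCoeff u 0 t = 0 := by
  filter_upwards [hu] with t ht
  simpa [torusCoeff] using ht

end

/-! ### Convolutions of integrable functions -/

/-- The convolution of two functions on the line. -/
noncomputable def lineConv (F G : ℝ → ℂ) (τ : ℝ) : ℂ := ∫ x, F x * G (τ - x)

theorem enorm_lineConv_le (F G : ℝ → ℂ) (τ : ℝ) :
    ‖lineConv F G τ‖ₑ ≤ lconv (fun x => ‖F x‖ₑ) (fun x => ‖G x‖ₑ) τ := by
  refine (enorm_integral_le_lintegral_enorm _).trans (le_of_eq ?_)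
  simp only [enorm_mul, lconv]

theorem measurable_lineConv {F G : ℝ → ℂ} (hF : Measurable F) (hG : Measurable G) :
    Measurable (lineConv F G) := by
  have h : StronglyMeasurable (fun p : ℝ × ℝ => F p.2 * G (p.1 - p.2)) :=
    (by fun_prop : Measurable fun p : ℝ × ℝ => F p.2 * G (p.1 - p.2)).stronglyMeasurable
  exact h.integral_prod_right'.measurable

theorem lintegral_enorm_lineConv_le {F G : ℝ → ℂ} (hF : Measurable F) (hG : Measurable G) :
    ∫⁻ τ, ‖lineConv F G τ‖ₑ ≤ (∫⁻ x, ‖F x‖ₑ) * ∫⁻ x, ‖G x‖ₑ := by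
  rw [← lintegral_lconv (by fun_prop) (by fun_prop)]
  exact lintegral_mono fun τ => enorm_lineConv_le F G τ

theorem integrable_lineConv {F G : ℝ → ℂ} (hF : Integrable F) (hG : Integrable G) :
    Integrable (lineConv F G) :=
  hF.integrable_convolution (ContinuousLinearMap.mul ℂ ℂ) hG

theorem fourierInv_lineConv {F G : ℝ → ℂ} (hF : Integrable F) (hG : Integrable G) (w : ℝ) :
    𝓕⁻ (lineConv F G) w = 𝓕⁻ F w * 𝓕⁻ G w := by
  simp only [Real.fourierInv_eq_fourier_neg]
  exact Real.fourier_mul_convolution_eq hF hG (-w)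

theorem integral_fourierInv_mul_fourierInv {F G : ℝ → ℂ} (hF : Integrable F) (hG : Integrable G)
    (φ : 𝓢(ℝ, ℂ)) :
    ∫ t : ℝ, 𝓕⁻ F (t / (2 * Real.pi)) * 𝓕⁻ G (t / (2 * Real.pi)) * 𝓕 φ (t / (2 * Real.pi)) =
      (2 * Real.pi : ℝ) * ∫ τ, lineConv F G τ * φ τ := by
  rw [← integral_fourierInv_mul_fourier (integrable_lineConv hF hG)]
  simp_rw [fourierInv_lineConv hF hG]

/-! ### The Fourier transform of `∂ₓ (u v)` -/

/-- The convolution of `U m` and `V (n - m)`, with the frequency `m = 0` removed. -/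
noncomputable def truncConv (U V : ℤ → ℝ → ℂ) (n m : ℤ) (τ : ℝ) : ℂ :=
  if m = 0 then 0 else lineConv (U m) (V (n - m)) τ

/-- The Fourier transform of `∂ₓ (u v)` in terms of those of `u` (of mean zero) and `v`. -/
noncomputable def bilinearFourier (lam : ℝ) (U V : ℤ → ℝ → ℂ) (n : ℤ) (τ : ℝ) : ℂ :=
  I * (n / lam) * (((2 * Real.pi)⁻¹ * (2 * Real.pi * lam)⁻¹ : ℝ) * ∑' m : ℤ, truncConv U V n m τ)

theorem dominatedByConv_bilinearFourier {lam : ℝ} (hl : 0 < lam) (U V : ℤ → ℝ → ℂ) :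
    DominatedByConv lam U V (bilinearFourier lam U V) := by
  intro n τ
  have hpi := Real.pi_gt_three
  have h1 : ‖(I * (n / lam) : ℂ)‖ₑ = ENNReal.ofReal |(n / lam : ℝ)| := by
    rw [← ofReal_norm, norm_mul, Complex.norm_I, one_mul, norm_div, Complex.norm_intCast,
      Complex.norm_real, abs_div, Real.norm_eq_abs]
  have h2 : ‖((((2 * Real.pi)⁻¹ * (2 * Real.pi * lam)⁻¹ : ℝ)) : ℂ)‖ₑ ≤
      ENNReal.ofReal (1 / (2 * Real.pi * lam)) := by
    rw [← ofReal_norm, Complex.norm_real, Real.norm_of_nonneg (by positivity)]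
    apply ENNReal.ofReal_le_ofReal
    rw [one_div]
    refine mul_le_of_le_one_left (by positivity) (inv_le_one_of_one_le₀ ?_)
    linarith
  have h3 : ‖∑' m : ℤ, truncConv U V n m τ‖ₑ ≤ ∑' m : ℤ, if m = 0 then 0 else
      lconv (fun x => ‖U m x‖ₑ) (fun x => ‖V (n - m) x‖ₑ) τ := by
    refine enorm_tsum_le_tsum_enorm.trans (ENNReal.tsum_le_tsum fun m => ?_)
    unfold truncConv
    split_ifs
    · simp
    · exact enorm_lineConv_le _ _ _
  unfold bilinearFourier
  rw [enorm_mul, h1, enorm_mul]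
  calc _ ≤ ENNReal.ofReal |(n / lam : ℝ)| * (ENNReal.ofReal (1 / (2 * Real.pi * lam)) *
        ∑' m : ℤ, if m = 0 then 0 else
          lconv (fun x => ‖U m x‖ₑ) (fun x => ‖V (n - m) x‖ₑ) τ) := by gcongr
    _ = _ := by ring

theorem ENNReal.tsum_mul_sub_lt_top {a b : ℤ → ℝ≥0∞} (ha : ∑' n, a n ^ 2 < ⊤)
    (hb : ∑' n, b n ^ 2 < ⊤) (n : ℤ) : ∑' m : ℤ, a m * b (n - m) < ⊤ := by
  have h := ENNReal.tsum_mul_sq_le a (fun m => b (n - m))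
  have e : ∑' m : ℤ, b (n - m) ^ 2 = ∑' m : ℤ, b m ^ 2 :=
    (Equiv.subLeft n).tsum_eq (fun m => b m ^ 2)
  rw [e] at h
  have := h.trans_lt (ENNReal.mul_lt_top ha hb)
  exact (ENNReal.pow_lt_top_iff.mp this).resolve_right (by norm_num)

/-- Measurable families with `∑ₙ (∫ |U n|)² < ∞`. -/
structure SqSummableL1 (U : ℤ → ℝ → ℂ) : Prop where
  measurable : ∀ n, Measurable (U n)
  tsum_lt_top : ∑' n : ℤ, (∫⁻ τ, ‖U n τ‖ₑ) ^ 2 < ⊤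

section
variable {U V : ℤ → ℝ → ℂ}

theorem SqSummableL1.integrable (hU : SqSummableL1 U) (n : ℤ) : Integrable (U n) := by
  refine ⟨(hU.measurable n).aestronglyMeasurable, ?_⟩
  have h := (ENNReal.le_tsum n).trans_lt hU.tsum_lt_top
  exact (ENNReal.pow_lt_top_iff.mp h).resolve_right (by norm_num)

theorem measurable_truncConv (hU : SqSummableL1 U) (hV : SqSummableL1 V) (n m : ℤ) :
    Measurable (truncConv U V n m) := by
  unfold truncConv
  split_ifs
  · exact measurable_const
  · exact measurable_lineConv (hU.measurable m) (hV.measurable (n - m))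

theorem tsum_lintegral_truncConv_lt_top (hU : SqSummableL1 U) (hV : SqSummableL1 V) (n : ℤ) :
    ∑' m : ℤ, ∫⁻ τ, ‖truncConv U V n m τ‖ₑ < ⊤ := by
  refine lt_of_le_of_lt (ENNReal.tsum_le_tsum fun m => ?_)
    (ENNReal.tsum_mul_sub_lt_top hU.tsum_lt_top hV.tsum_lt_top n)
  unfold truncConv
  split_ifs
  · simp
  · exact lintegral_enorm_lineConv_le (hU.measurable m) (hV.measurable (n - m))

theorem integrable_tsum_truncConv (hU : SqSummableL1 U) (hV : SqSummableL1 V) (n : ℤ) :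
    Integrable fun τ => ∑' m : ℤ, truncConv U V n m τ := by
  refine ⟨(Measurable.tsum fun m => measurable_truncConv hU hV n m).aestronglyMeasurable, ?_⟩
  refine lt_of_le_of_lt ?_ (tsum_lintegral_truncConv_lt_top hU hV n)
  rw [← lintegral_tsum fun m => (measurable_truncConv hU hV n m).enorm.aemeasurable]
  exact lintegral_mono fun τ => enorm_tsum_le_tsum_enorm

theorem SchwartzMap.exists_enorm_le (φ : 𝓢(ℝ, ℂ)) :
    ∃ C : ℝ≥0∞, C ≠ ⊤ ∧ ∀ x, ‖φ x‖ₑ ≤ C :=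
  ⟨ENNReal.ofReal (SchwartzMap.seminorm ℝ 0 0 φ), ENNReal.ofReal_ne_top, fun x => by
    rw [← ofReal_norm]
    exact ENNReal.ofReal_le_ofReal (SchwartzMap.norm_le_seminorm ℝ φ x)⟩

theorem integral_tsum_truncConv_mul (hU : SqSummableL1 U) (hV : SqSummableL1 V) (n : ℤ)
    (φ : 𝓢(ℝ, ℂ)) :
    ∫ τ, (∑' m : ℤ, truncConv U V n m τ) * φ τ = ∑' m : ℤ, ∫ τ, truncConv U V n m τ * φ τ := by
  obtain ⟨C, hC, hφ⟩ := SchwartzMap.exists_enorm_le φ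
  simp_rw [← tsum_mul_right]
  refine integral_tsum (fun m => ?_) (ne_of_lt ?_)
  · exact ((measurable_truncConv hU hV n m).mul φ.continuous.measurable).aestronglyMeasurable
  · calc ∑' m : ℤ, ∫⁻ τ, ‖truncConv U V n m τ * φ τ‖ₑ
        ≤ ∑' m : ℤ, ∫⁻ τ, ‖truncConv U V n m τ‖ₑ * C := by
          gcongr with m τ
          rw [enorm_mul]
          gcongr
          exact hφ τ
      _ = (∑' m : ℤ, ∫⁻ τ, ‖truncConv U V n m τ‖ₑ) * C := by
          simp_rw [lintegral_mul_const' _ _ hC]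
          rw [ENNReal.tsum_mul_right]
      _ < ⊤ := ENNReal.mul_lt_top (tsum_lintegral_truncConv_lt_top hU hV n) hC.lt_top

/-- The product of the inverse Fourier transforms of `U m` and `V (n - m)`, paired with `φ`. -/
noncomputable def pairing (c : ℂ) (U V : ℤ → ℝ → ℂ) (φ : 𝓢(ℝ, ℂ)) (n m : ℤ) (t : ℝ) : ℂ :=
  if m = 0 then 0 else c * (𝓕⁻ (U m) (t / (2 * Real.pi)) * 𝓕⁻ (V (n - m)) (t / (2 * Real.pi)) *
    𝓕 φ (t / (2 * Real.pi)))

theorem integral_tsum_pairing (c : ℂ) (hU : SqSummableL1 U) (hV : SqSummableL1 V) (n : ℤ)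
    (φ : 𝓢(ℝ, ℂ)) :
    ∫ t, ∑' m : ℤ, pairing c U V φ n m t =
      c * (2 * Real.pi : ℝ) * ∫ τ, (∑' m : ℤ, truncConv U V n m τ) * φ τ := by
  have hφ : ∫⁻ t, ‖angularFourier φ t‖ₑ < ⊤ := (angularFourier φ).integrable.2
  rw [integral_tsum_truncConv_mul hU hV, integral_tsum]
  · rw [← tsum_mul_left]
    refine tsum_congr fun m => ?_
    unfold pairing truncConv
    split_ifs with hm
    · simp
    · rw [integral_const_mul, integral_fourierInv_mul_fourierInv (hU.integrable m)
        (hV.integrable (n - m))]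
      ring
  · intro m
    unfold pairing
    split_ifs with hm
    · exact aestronglyMeasurable_const
    · have h1 := continuous_fourierInv (hU.integrable m)
      have h2 := continuous_fourierInv (hV.integrable (n - m))
      have h3 := (𝓕 φ).continuous
      exact Continuous.aestronglyMeasurable (by fun_prop)
  · refine ne_of_lt ?_
    calc ∑' m : ℤ, ∫⁻ t, ‖pairing c U V φ n m t‖ₑ
        ≤ ∑' m : ℤ, ∫⁻ t, ‖c‖ₑ * ((∫⁻ x, ‖U m x‖ₑ) * (∫⁻ x, ‖V (n - m) x‖ₑ)) *
            ‖angularFourier φ t‖ₑ := by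
          gcongr with m t
          unfold pairing
          split_ifs with hm
          · simp
          · rw [enorm_mul, enorm_mul, enorm_mul, ← angularFourier_apply, ← mul_assoc]
            gcongr
            · exact enorm_fourierInv_le _ _
            · exact enorm_fourierInv_le _ _
      _ = ‖c‖ₑ * (∑' m : ℤ, (∫⁻ x, ‖U m x‖ₑ) * (∫⁻ x, ‖V (n - m) x‖ₑ)) *
            ∫⁻ t, ‖angularFourier φ t‖ₑ := by
          simp_rw [lintegral_const_mul _ (angularFourier φ).continuous.measurable.enorm]
          rw [ENNReal.tsum_mul_right, ENNReal.tsum_mul_left]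
      _ < ⊤ := ENNReal.mul_lt_top (ENNReal.mul_lt_top enorm_lt_top
          (ENNReal.tsum_mul_sub_lt_top hU.tsum_lt_top hV.tsum_lt_top n)) hφ

theorem isSpaceTimeFourier_weakDx_mul {lam : ℝ} [Fact (0 < 2 * Real.pi * lam)] (hl : 0 < lam)
    {u v : Torus lam × ℝ → ℂ} (hu : MemLp u 2) (hv : MemLp v 2) (hu0 : MeanZero lam u)
    (hU : IsSpaceTimeFourier (ofFunction lam u) U) (hV : IsSpaceTimeFourier (ofFunction lam v) V)
    (hU1 : SqSummableL1 U) (hV1 : SqSummableL1 V) :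
    IsSpaceTimeFourier (weakDx (ofFunction lam fun p => u p * v p)) (bilinearFourier lam U V) := by
  intro n φ
  have hpi := Real.pi_pos
  constructor
  · have h := (integrable_tsum_truncConv hU1 hV1 n).mul_bdd
      (c := SchwartzMap.seminorm ℝ 0 0 φ) φ.continuous.aestronglyMeasurable
      (Filter.Eventually.of_forall fun x => SchwartzMap.norm_le_seminorm ℝ φ x)
    refine (h.const_mul (I * (n / lam) *
      (((2 * Real.pi)⁻¹ * (2 * Real.pi * lam)⁻¹ : ℝ) : ℂ))).congr
      (Filter.Eventually.of_forall fun τ => ?_)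
    simp only [bilinearFourier]
    ring
  set c : ℂ := ((2 * Real.pi * lam : ℝ) : ℂ)⁻¹ * (((2 * Real.pi)⁻¹ : ℝ) * ((2 * Real.pi)⁻¹ : ℝ))
    with hc
  have hae : ∀ᵐ t, torusCoeff (fun p => u p * v p) n t * 𝓕 φ (t / (2 * Real.pi)) =
      ∑' m : ℤ, pairing c U V φ n m t := by
    have h1 : ∀ᵐ t, ∀ m : ℤ, torusCoeff u m t =
        (2 * Real.pi : ℝ)⁻¹ * 𝓕⁻ (U m) (t / (2 * Real.pi)) :=
      ae_all_iff.mpr fun m => ae_torusCoeff_eq hu hU (hU1.integrable m)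
    have h2 : ∀ᵐ t, ∀ m : ℤ, torusCoeff v m t =
        (2 * Real.pi : ℝ)⁻¹ * 𝓕⁻ (V m) (t / (2 * Real.pi)) :=
      ae_all_iff.mpr fun m => ae_torusCoeff_eq hv hV (hV1.integrable m)
    filter_upwards [h1, h2, ae_torusCoeff_zero hu0, ae_hasSum_torusCoeff hu hv n]
      with t ht1 ht2 ht3 ht4
    rw [← ht4.tsum_eq, ← tsum_mul_right]
    refine tsum_congr fun m => ?_
    unfold pairing
    split_ifs with hm
    · rw [hm, ht3]; simp
    · rw [ht1, ht2, hc]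
      push_cast
      ring
  have hmain : ofFunction lam (fun p => u p * v p) (fourierTest lam n φ) =
      c * (2 * Real.pi : ℝ) * ∫ τ, (∑' m : ℤ, truncConv U V n m τ) * φ τ := by
    rw [ofFunction_fourierTest (integrable_mul_mul_fourierTest hu hv n φ), integral_congr_ae hae,
      integral_tsum_pairing c hU1 hV1]
  have hw : weakDx (ofFunction lam fun p => u p * v p) (fourierTest lam n φ) =
      I * (n / lam) * ofFunction lam (fun p => u p * v p) (fourierTest lam n φ) := by
    unfold weakDx
    simp_rw [deriv_fourierTest hl]
    unfold ofFunction
    rw [← integral_const_mul, ← integral_neg]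
    refine integral_congr_ae (Filter.Eventually.of_forall fun p => ?_)
    simp only
    ring
  rw [hw, hmain]
  have e : ∀ τ, bilinearFourier lam U V n τ * φ τ = I * (n / lam) *
      ((((2 * Real.pi)⁻¹ * (2 * Real.pi * lam)⁻¹ : ℝ) : ℂ) *
        ((∑' m : ℤ, truncConv U V n m τ) * φ τ)) := by
    intro τ
    unfold bilinearFourier
    ring
  simp_rw [e]
  rw [integral_const_mul, integral_const_mul]
  congr 1
  congr 1
  rw [hc]
  have h2 : (Real.pi : ℂ) ≠ 0 := by exact_mod_cast Real.pi_ne_zero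
  have h3 : (lam : ℂ) ≠ 0 := by exact_mod_cast hl.ne'
  push_cast
  field_simp

end

/-! ### The bilinear estimate -/

theorem IsSpaceTimeFourier.aestronglyMeasurable {lam : ℝ} {F : Functional lam} {U : ℤ → ℝ → ℂ}
    (h : IsSpaceTimeFourier F U) (n : ℤ) : AEStronglyMeasurable (U n) := by
  let χ : ℕ → ContDiffBump (0 : ℝ) := fun k =>
    { rIn := k + 1, rOut := k + 2, rIn_pos := by positivity, rIn_lt_rOut := by linarith }
  have hs : ∀ k, HasCompactSupport fun x : ℝ => (χ k x : ℂ) := fun k =>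
    (χ k).hasCompactSupport.comp_left (g := fun r : ℝ => (r : ℂ)) (by simp)
  have hd : ∀ k, ContDiff ℝ (⊤ : ℕ∞) fun x : ℝ => (χ k x : ℂ) := fun k =>
    Complex.ofRealCLM.contDiff.comp (χ k).contDiff
  refine aestronglyMeasurable_of_tendsto_ae Filter.atTop
    (f := fun (k : ℕ) τ => U n τ * (hs k).toSchwartzMap (hd k) τ) (fun k => (h n _).1.1)
    (Filter.Eventually.of_forall fun τ => ?_)
  refine tendsto_const_nhds.congr' ?_
  obtain ⟨N, hN⟩ := exists_nat_ge |τ|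
  filter_upwards [Filter.eventually_ge_atTop N] with k hk
  have hk' : (N : ℝ) ≤ k := by exact_mod_cast hk
  have h1 : χ k τ = 1 := by
    apply (χ k).one_of_mem_closedBall
    rw [mem_closedBall_zero_iff, Real.norm_eq_abs]
    change |τ| ≤ (k : ℝ) + 1
    linarith
  change U n τ = U n τ * ((χ k τ : ℝ) : ℂ)
  rw [h1]
  simp

theorem IsSpaceTimeFourier.congr_ae {lam : ℝ} {F : Functional lam} {U V : ℤ → ℝ → ℂ}
    (h : IsSpaceTimeFourier F U) (hUV : ∀ n, U n =ᵐ[volume] V n) : IsSpaceTimeFourier F V := by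
  intro n φ
  have e : (fun τ => U n τ * φ τ) =ᵐ[volume] fun τ => V n τ * φ τ := by
    filter_upwards [hUV n] with τ hτ
    rw [hτ]
  exact ⟨(h n φ).1.congr e, (h n φ).2.trans (integral_congr_ae e)⟩

section
variable {lam : ℝ} {U V : ℤ → ℝ → ℂ}

theorem weighted_congr_ae (hUV : ∀ n, U n =ᵐ[volume] V n) (α s b : ℝ) (n : ℤ) :
    weighted lam α s b U n =ᵐ[volume] weighted lam α s b V n := by
  filter_upwards [hUV n] with τ hτ
  simp only [weighted, hτ]

theorem normL2L2_congr_ae (hUV : ∀ n, U n =ᵐ[volume] V n) (α s b : ℝ) :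
    normL2L2 lam α s b U = normL2L2 lam α s b V := by
  unfold normL2L2
  have : ∀ n, ∫⁻ τ, weighted lam α s b U n τ ^ 2 = ∫⁻ τ, weighted lam α s b V n τ ^ 2 := fun n =>
    lintegral_congr_ae ((weighted_congr_ae hUV α s b n).pow_const 2)
  simp_rw [this]

theorem normL2L1_congr_ae (hUV : ∀ n, U n =ᵐ[volume] V n) (α s b : ℝ) :
    normL2L1 lam α s b U = normL2L1 lam α s b V := by
  unfold normL2L1
  have : ∀ n, ∫⁻ τ, weighted lam α s b U n τ = ∫⁻ τ, weighted lam α s b V n τ := fun n =>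
    lintegral_congr_ae (weighted_congr_ae hUV α s b n)
  simp_rw [this]

theorem sqSummableL1_of_normL2L1_lt_top (hl : 0 < lam) {α s : ℝ} (hs : 0 ≤ s)
    (hU : ∀ n, Measurable (U n)) (h : normL2L1 lam α s 0 U < ⊤) : SqSummableL1 U := by
  refine ⟨hU, ?_⟩
  have hpi := Real.pi_pos
  unfold normL2L1 at h
  rw [ENNReal.rpow_lt_top_iff_of_pos (by norm_num)] at h
  have hκ : ENNReal.ofReal (1 / (2 * Real.pi * lam)) ≠ 0 := by
    rw [ne_eq, ENNReal.ofReal_eq_zero, not_le]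
    positivity
  have h2 := ENNReal.lt_top_of_mul_ne_top_right h.ne hκ
  refine lt_of_le_of_lt (ENNReal.tsum_le_tsum fun n => ?_) h2
  gcongr with τ
  rw [weighted_eq, modWeight_zero, one_mul]
  exact le_mul_of_one_le_left' (ENNReal.one_le_ofReal.mpr (Real.one_le_rpow (one_le_bracket _) hs))

end

theorem ENNReal.le_mul_of_forall_gt {x k a : ℝ≥0∞} (hk : k ≠ ⊤) (ha : a < ⊤)
    (h : ∀ c, a < c → c < ⊤ → x ≤ k * c) : x ≤ k * a := by
  have : (nhdsWithin a (Set.Ioi a)).NeBot := nhdsGT_neBot_of_exists_gt ⟨⊤, ha⟩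
  have ht : Filter.Tendsto (fun c => k * c) (nhdsWithin a (Set.Ioi a)) (nhds (k * a)) :=
    (ENNReal.continuous_const_mul hk).continuousAt.tendsto.mono_left nhdsWithin_le_nhds
  refine ge_of_tendsto ht ?_
  filter_upwards [Ioo_mem_nhdsGT ha] with c hc
  exact h c hc.1 hc.2

/-- The bilinear estimate, with the constant `D` of the multiplier bound. -/
theorem normZ_weakDx_mul_le {lam α s : ℝ} [Fact (0 < 2 * Real.pi * lam)] (hl : 1 ≤ lam)
    (hs : 0 ≤ s) {D : ℝ≥0∞} (hDtop : D ≠ ⊤)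
    (hD : ∀ n : ℤ, ∑' m : ℤ, (if m = 0 then 0 else
        ENNReal.ofReal (multiplierSq α s (n / lam) (m / lam) / lam)) ≤ D)
    {u v : Torus lam × ℝ → ℂ} (hu : MemY lam 1 s u) (hv : MemY lam α s v)
    (hu0 : MeanZero lam u) :
    normZ α s (weakDx (ofFunction lam (fun p => u p * v p))) ≤
      2 * (9 * (1 + modConst) * D) ^ (1 / 2 : ℝ) *
        normY 1 s (ofFunction lam u) * normY α s (ofFunction lam v) := by
  have h0 : 0 < lam := by linarith
  set K : ℝ≥0∞ := 2 * (9 * (1 + modConst) * D) ^ (1 / 2 : ℝ) with hK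
  have hKtop : K ≠ ⊤ := by
    have h1 : 1 + modConst ≠ ⊤ := by simpa using modConst_lt_top.ne
    refine ENNReal.mul_ne_top (by norm_num) (ENNReal.rpow_ne_top_of_nonneg (by norm_num) ?_)
    exact ENNReal.mul_ne_top (ENNReal.mul_ne_top (by norm_num) h1) hDtop
  have hYu := hu.2
  have hYv := hv.2
  have core : ∀ c, normY 1 s (ofFunction lam u) < c → ∀ d, normY α s (ofFunction lam v) < d →
      normZ α s (weakDx (ofFunction lam (fun p => u p * v p))) ≤ K * c * d := by
    intro c hc d hd
    unfold normY at hc hd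
    simp only [iInf_lt_iff] at hc hd
    obtain ⟨U, hU, hUc⟩ := hc
    obtain ⟨V, hV, hVd⟩ := hd
    set U' : ℤ → ℝ → ℂ := fun n => (hU.aestronglyMeasurable n).mk (U n)
    set V' : ℤ → ℝ → ℂ := fun n => (hV.aestronglyMeasurable n).mk (V n)
    have hUU : ∀ n, U n =ᵐ[volume] U' n := fun n => (hU.aestronglyMeasurable n).ae_eq_mk
    have hVV : ∀ n, V n =ᵐ[volume] V' n := fun n => (hV.aestronglyMeasurable n).ae_eq_mk
    have hUm : ∀ n, Measurable (U' n) := fun n =>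
      (hU.aestronglyMeasurable n).stronglyMeasurable_mk.measurable
    have hVm : ∀ n, Measurable (V' n) := fun n =>
      (hV.aestronglyMeasurable n).stronglyMeasurable_mk.measurable
    rw [normL2L2_congr_ae hUU, normL2L1_congr_ae hUU] at hUc
    rw [normL2L2_congr_ae hVV, normL2L1_congr_ae hVV] at hVd
    have hU1 : SqSummableL1 U' := sqSummableL1_of_normL2L1_lt_top h0 hs hUm
      (lt_of_le_of_lt le_add_self (hUc.trans_le le_top))
    have hV1 : SqSummableL1 V' := sqSummableL1_of_normL2L1_lt_top h0 hs hVm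
      (lt_of_le_of_lt le_add_self (hVd.trans_le le_top))
    have hW := isSpaceTimeFourier_weakDx_mul h0 hu.1 hv.1 hu0 (hU.congr_ae hUU) (hV.congr_ae hVV)
      hU1 hV1
    refine (iInf₂_le _ hW).trans ((fourier_side_estimate hl hUm hVm
      (dominatedByConv_bilinearFourier h0 U' V') hD).trans ?_)
    gcongr
  have step : ∀ c, normY 1 s (ofFunction lam u) < c → c < ⊤ →
      normZ α s (weakDx (ofFunction lam (fun p => u p * v p))) ≤
        K * normY α s (ofFunction lam v) * c := by
    intro c hc hc'
    rw [mul_right_comm]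
    exact ENNReal.le_mul_of_forall_gt (ENNReal.mul_ne_top hKtop hc'.ne) hYv
      fun d hd _ => core c hc d hd
  rw [mul_right_comm]
  exact ENNReal.le_mul_of_forall_gt (ENNReal.mul_ne_top hKtop hYv.ne) hYu step

theorem mainTheorem7 (α : ℝ) (hα0 : 0 < α) (hα1 : α < 1) (s ε δ : ℝ) (hε : 0 < ε) (hδ : 0 < δ)
    (hs : min 1 (1 / 2 + maxTypeIndex α / 2 + ENNReal.ofReal ε) ≤ ENNReal.ofReal s) :
    ∃ C : ℝ, 0 < C ∧ ∀ (lam : ℝ) [Fact (0 < 2 * Real.pi * lam)], 1 ≤ lam →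
      ∀ u v : Torus lam × ℝ → ℂ, MemY lam 1 s u → MemY lam α s v → MeanZero lam u →
        normZ α s (weakDx (ofFunction lam (fun p => u p * v p))) ≤
          ENNReal.ofReal (C * constC2 α δ lam) *
            normY 1 s (ofFunction lam u) * normY α s (ofFunction lam v) := by
  obtain ⟨C, hC, hb⟩ := exists_tsum_multiplierSq_le hα0 hα1 hε hδ hs
  have hs0 : 0 ≤ s := by linarith [half_lt_of_threshold hε hs]
  set M := modConst.toReal
  have hM : modConst = ENNReal.ofReal M := (ENNReal.ofReal_toReal modConst_lt_top.ne).symm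
  have hM0 : 0 ≤ M := ENNReal.toReal_nonneg
  refine ⟨2 * Real.sqrt (9 * (1 + M) * C), by positivity, ?_⟩
  intro lam _ hl u v hu hv hu0
  have hc := constC2_pos (α := α) (δ := δ) hl
  refine (normZ_weakDx_mul_le hl hs0 ENNReal.ofReal_ne_top (hb lam hl) hu hv hu0).trans
    (le_of_eq ?_)
  congr 2
  have e1 : 9 * (1 + modConst) * ENNReal.ofReal (C * constC2 α δ lam ^ 2) =
      ENNReal.ofReal (9 * (1 + M) * (C * constC2 α δ lam ^ 2)) := by
    rw [ENNReal.ofReal_mul (p := 9 * (1 + M)) (by positivity),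
      ENNReal.ofReal_mul (p := 9) (by norm_num), ENNReal.ofReal_add (by norm_num) hM0, hM]
    simp
  rw [e1, ENNReal.ofReal_rpow_of_nonneg (by positivity) (by norm_num), ← Real.sqrt_eq_rpow,
    show 9 * (1 + M) * (C * constC2 α δ lam ^ 2) = 9 * (1 + M) * C * constC2 α δ lam ^ 2 by ring,
    Real.sqrt_mul (by positivity), Real.sqrt_sq hc.le, mul_assoc (2 : ℝ) (Real.sqrt _),
    ENNReal.ofReal_mul (p := 2) (by norm_num)]
  simp
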